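/- Theorem 1.4. For an integer $d\ge 1$ and $p\in[0,1]$, consider Mandelbrot fractal percolation on $\mathbb{R}^d$ with $N=2$ and retention probability $p$. To every integer $j\ge 0$ and every $z\in\mathbb{Z}^d$ attach the closed box $B_{j,z}=2^{-j}(z+[0,1]^d)$, and let all these boxes carry independent coins, each showing "keep" with probability $p$; let $\mathbb{P}_p$ be the resulting law. A box of scale $0$ is retained if and only if its coin shows "keep"; for $j\ge 0$, each retained box of scale $j$ is divided into its $2^d$ sub-boxes of scale $j+1$, and each of these is retained if and only if its own coin shows "keep" (sub-boxes of a box that is not retained are not retained). Let $A'_\infty=\bigcap_{j\ge 0}\bigcup\{B_{j,z}: B_{j,z}\text{ is retained}\}$. An unbounded path in $A'_\infty$ is an unbounded set of the form $\gamma([0,\infty))\subset A'_\infty$ with $\gamma:[0,\infty)\to\mathbb{R}^d$ continuous. Put $$p_c(d)=\inf\{p\in[0,1] : \mathbb{P}_p[\text{there exists an unbounded path in }A'_\infty]>0\}.$$ Then $\lim_{d\to\infty}p_c(d)=0$. -/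

import Mathlib

open MeasureTheory Filter Topology
open scoped unitInterval

namespace FractalPercolation

/-- A dyadic box index `(j, z)` in dimension `d`: the scale `j` together with the integer vector
`z`, standing for the cube `2^{-j} (z + [0,1]^d)`. -/
abbrev BoxIndex (d : ℕ) : Type := ℕ × (Fin d → ℤ)

/-- A configuration: for each dyadic box, the outcome of its coin (`true` means "keep"). -/
abbrev Config (d : ℕ) : Type := BoxIndex d → Bool

/-- The closed cube `2^{-j} (z + [0,1]^d) ⊆ ℝ^d`. -/
def closedBox {d : ℕ} (j : ℕ) (z : Fin d → ℤ) : Set (EuclideanSpace ℝ (Fin d)) :=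
  {x | ∀ i, (z i : ℝ) / 2 ^ j ≤ x i ∧ x i ≤ ((z i : ℝ) + 1) / 2 ^ j}

/-- The index at scale `j` of the cube containing the cube of index `z` at scale `j + 1`
(here `/` is floor division by `2`). -/
def parent {d : ℕ} (z : Fin d → ℤ) : Fin d → ℤ := fun i => z i / 2

/-- The boxes retained at scale `j`. At scale `0` a unit box is retained iff its coin says so;
at scale `j + 1` every retained box of scale `j` is divided into `2^d` sub-boxes, each of which
is retained iff its own coin says so. -/
def retainedBoxes {d : ℕ} (ω : Config d) : ℕ → Set (Fin d → ℤ)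
  | 0 => {z | ω (0, z) = true}
  | j + 1 => {z | parent z ∈ retainedBoxes ω j ∧ ω (j + 1, z) = true}

/-- The retained set of fractal percolation: the intersection over all scales of the union of the
closed boxes retained at that scale. -/
def retainedSet {d : ℕ} (ω : Config d) : Set (EuclideanSpace ℝ (Fin d)) :=
  ⋂ j : ℕ, ⋃ z ∈ retainedBoxes ω j, closedBox j z

/-- `A` contains an unbounded path: the image of a continuous map `[0, ∞) → ℝ^d` which is
contained in `A` and unbounded. -/
def ContainsUnboundedPath {d : ℕ} (A : Set (EuclideanSpace ℝ (Fin d))) : Prop :=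
  ∃ γ : ℝ → EuclideanSpace ℝ (Fin d), ContinuousOn γ (Set.Ici 0) ∧
    γ '' Set.Ici 0 ⊆ A ∧ ¬ Bornology.IsBounded (γ '' Set.Ici 0)

/-- The law `ℙ_p` of the configuration: the coins of all boxes at all scales are independent, each
being `true` with probability `p` and `false` with probability `1 - p`. -/
noncomputable def law (d : ℕ) (p : I) : Measure (Config d) :=
  Measure.infinitePi fun _ : BoxIndex d => ProbabilityTheory.bernoulliMeasure true false p

/-- The critical probability
`p_c(d) = inf {p ∈ [0,1] : ℙ_p[the retained set contains an unbounded path] > 0}`. -/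
noncomputable def criticalProbability (d : ℕ) : ℝ :=
  ((sInf {p : I | 0 < law d p {ω | ContainsUnboundedPath (retainedSet ω)}} : I) : ℝ)

end FractalPercolation

/-! Fix `p` strictly between 0 and 1. The theorem follows once an unbounded path has positive
probability for all large `d`, and this is shown by renormalisation. An edge between neighbouring
boxes is good if most hubs of one are joined to most hubs of the other through good edges one scale
finer. Two given hubs are joined by about `d` candidate paths of six edges with disjoint interiors,
each interior open with probability at least `p ^ 5`. So a shortage of open paths has probability at
most `pathError`, which decays exponentially in `d`; call it η.

When there is no shortage, bad finer edges can do harm only if two of them are disjoint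
(`hubsLinked_of_manyPaths`). Disjoint edges are independent, so a bound δ becomes `η + 36 d^6 δ^2`
(`measureReal_notMem_coarsen_le`). Starting from δ = 0 arbitrarily many scales ahead, the bound
stays below 2η, and this survives the limit that defines `goodEdges`.

Two majorities among the same hubs always meet, so one hub per box can be chosen with hubs of linked
boxes joined nearby (`exists_hub`). Nested hubs shrink to points, and successive chains converge
uniformly to paths in the retained set (`joinedIn_of_refinement`).

The same coarsening is applied upwards to blocks of side `2 ^ k`. There no new coins enter, the term
η disappears beyond the first step, and the bounds become summable. With positive probability all
block edges at the origin are good, and following hubs from block to block leads to infinity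
(`containsUnboundedPath_of_blockEdges`). -/

namespace FractalPercolation

/-! ### Combinatorics of one coarsening step -/

open Relation

variable {d : ℕ}

/-- The `a`-th standard basis vector of `ℤ^d`. -/
abbrev basisVec (a : Fin d) : Fin d → ℤ := Pi.single a 1

/-- Two neighbouring boxes of one scale are linked if both are open and the edge joining them is
good. An edge is given by its lower endpoint and its direction. -/
def Link (o : Set (Fin d → ℤ)) (g : Set ((Fin d → ℤ) × Fin d)) (w w' : Fin d → ℤ) : Prop :=
  w ∈ o ∧ w' ∈ o ∧
    ∃ k, (w' = w + basisVec k ∧ (w, k) ∈ g) ∨ (w = w' + basisVec k ∧ (w', k) ∈ g)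

lemma Link.symm {o : Set (Fin d → ℤ)} {g : Set ((Fin d → ℤ) × Fin d)} {w w' : Fin d → ℤ}
    (h : Link o g w w') : Link o g w' w :=
  ⟨h.2.1, h.1, h.2.2.imp fun _ => Or.symm⟩

open Classical in
/-- The hubs of a box are its open children in the positions `e_a`. -/
noncomputable def hubs (o : Set (Fin d → ℤ)) (z : Fin d → ℤ) : Finset (Fin d) :=
  {a | z + z + basisVec a ∈ o}

lemma mem_hubs {o : Set (Fin d → ℤ)} {z : Fin d → ℤ} {a : Fin d} :
    a ∈ hubs o z ↔ z + z + basisVec a ∈ o := by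
  simp [hubs]

/-- `w` is a child of one of the endpoints of the edge `(z, i)`. -/
def IsChild (z : Fin d → ℤ) (i : Fin d) (w : Fin d → ℤ) : Prop :=
  parent w = z ∨ parent w = z + basisVec i

/-- A majority of the hubs of `z` is connected to a majority of the hubs of `z + e_i` by chains of
links between children of these two boxes. -/
def HubsLinked (o : Set (Fin d → ℤ)) (g : Set ((Fin d → ℤ) × Fin d)) (z : Fin d → ℤ) (i : Fin d) :
    Prop :=
  ∃ K ⊆ hubs o z, ∃ K' ⊆ hubs o (z + basisVec i),
    (hubs o z).card < 2 * K.card ∧ (hubs o (z + basisVec i)).card < 2 * K'.card ∧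
    ∀ a ∈ K, ∀ b ∈ K', ReflTransGen (fun w w' => Link o g w w' ∧ IsChild z i w ∧ IsChild z i w')
      (z + z + basisVec a) (z + basisVec i + (z + basisVec i) + basisVec b)

/-- The good edges of the coarser lattice. -/
def coarsen (o : Set (Fin d → ℤ)) (g : Set ((Fin d → ℤ) × Fin d)) : Set ((Fin d → ℤ) × Fin d) :=
  {q | HubsLinked o g q.1 q.2}

lemma parent_child (z : Fin d → ℤ) (a : Fin d) : parent (z + z + basisVec a) = z := by
  funext c
  simp only [parent, Pi.add_apply, Pi.single_apply]
  split_ifs <;> omega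

lemma parent_double (z : Fin d → ℤ) : parent (z + z) = z := by
  funext c
  simp only [parent, Pi.add_apply]
  omega

/-- Linking is local: only children of the two boxes matter. Openness has to agree exactly, because
the number of hubs sets the majority threshold, whereas goodness may increase. Locality gives
measurability, compactness of coarsening, and the exchange of open boxes for retained ones. -/
lemma HubsLinked.mono {o o' : Set (Fin d → ℤ)} {g g' : Set ((Fin d → ℤ) × Fin d)} {z : Fin d → ℤ}
    {i : Fin d} (ho : ∀ w, IsChild z i w → (w ∈ o ↔ w ∈ o'))
    (hg : ∀ w k, IsChild z i w → IsChild z i (w + basisVec k) → (w, k) ∈ g → (w, k) ∈ g')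
    (h : HubsLinked o g z i) :
    HubsLinked o' g' z i := by
  have h1 : hubs o z = hubs o' z := by
    ext a
    simp only [mem_hubs]
    exact ho _ (Or.inl (parent_child z a))
  have h2 : hubs o (z + basisVec i) = hubs o' (z + basisVec i) := by
    ext a
    simp only [mem_hubs]
    exact ho _ (Or.inr (parent_child _ a))
  obtain ⟨K, hK, K', hK', hc, hc', hp⟩ := h
  rw [h1] at hK hc
  rw [h2] at hK' hc'
  refine ⟨K, hK, K', hK', hc, hc', fun a ha b hb => ReflTransGen.mono ?_ _ _ (hp a ha b hb)⟩
  rintro w w' ⟨⟨hw, hw', k, hk⟩, hn, hn'⟩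
  refine ⟨⟨(ho _ hn).1 hw, (ho _ hn').1 hw', k, ?_⟩, hn, hn'⟩
  rcases hk with ⟨rfl, hk⟩ | ⟨rfl, hk⟩
  · exact Or.inl ⟨rfl, hg _ _ hn hn' hk⟩
  · exact Or.inr ⟨rfl, hg _ _ hn' hn hk⟩

lemma coarsen_mono (o : Set (Fin d → ℤ)) {g g' : Set ((Fin d → ℤ) × Fin d)} (h : g ⊆ g') :
    coarsen o g ⊆ coarsen o g' :=
  fun _ hq => HubsLinked.mono (fun _ _ => Iff.rfl) (fun _ _ _ _ hw => h hw) hq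

lemma finite_isChild (z : Fin d → ℤ) (i : Fin d) : {w | IsChild z i w}.Finite := by
  have key : ∀ y : Fin d → ℤ, {w : Fin d → ℤ | parent w = y}.Finite := by
    intro y
    refine (Set.finite_Icc (y + y) (y + y + 1)).subset ?_
    rintro w rfl
    constructor <;> intro c <;> simp only [parent, Pi.add_apply, Pi.one_apply] <;> omega
  exact (key z).union (key _)

/-- Coarsening commutes with decreasing intersections of sets of good edges. -/
lemma iInter_coarsen_subset (o : Set (Fin d → ℤ)) {g : ℕ → Set ((Fin d → ℤ) × Fin d)}
    (hg : Antitone g) : ⋂ n, coarsen o (g n) ⊆ coarsen o (⋂ n, g n) := by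
  classical
  rintro ⟨z, i⟩ hq
  rw [Set.mem_iInter] at hq
  have hstab : ∀ q : (Fin d → ℤ) × Fin d, ∃ N, ∀ n, N ≤ n → q ∈ g n → q ∈ ⋂ n, g n := by
    intro q
    by_cases h : ∃ N, q ∉ g N
    · obtain ⟨N, hN⟩ := h
      exact ⟨N, fun n hn hq => absurd (hg hn hq) hN⟩
    · push Not at h
      exact ⟨0, fun n _ _ => Set.mem_iInter.2 h⟩
  choose N hN using hstab
  -- Finitely many edges are relevant, so a single stage serves them all.
  obtain ⟨M, hM⟩ : ∃ M, ∀ q ∈ {w | IsChild z i w} ×ˢ (Set.univ : Set (Fin d)), N q ≤ M :=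
    (((finite_isChild z i).prod Set.finite_univ).image N).bddAbove.imp
      fun M hM q hq => hM ⟨q, hq, rfl⟩
  exact HubsLinked.mono (fun _ _ => Iff.rfl)
    (fun w k hw _ hk => hN _ M (hM _ ⟨hw, trivial⟩) hk) (hq M)

/-- The vertices of the `k`-th path from the hub `a` of `z` to the hub `b` of `z + e_i`. -/
def pathVertex (z : Fin d → ℤ) (i a b k : Fin d) : Fin 7 → (Fin d → ℤ)
  | 0 => z + z + basisVec a
  | 1 => z + z + basisVec a + basisVec k
  | 2 => z + z + basisVec a + basisVec k + basisVec i
  | 3 => z + z + basisVec a + basisVec k + basisVec i + basisVec i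
  | 4 => z + z + basisVec k + basisVec i + basisVec i
  | 5 => z + z + basisVec k + basisVec i + basisVec i + basisVec b
  | 6 => z + basisVec i + (z + basisVec i) + basisVec b

/-- The edges of the `k`-th path from the hub `a` of `z` to the hub `b` of `z + e_i`. -/
def pathEdge (z : Fin d → ℤ) (i a b k : Fin d) : Fin 6 → (Fin d → ℤ) × Fin d
  | 0 => (pathVertex z i a b k 0, k)
  | 1 => (pathVertex z i a b k 1, i)
  | 2 => (pathVertex z i a b k 2, i)
  | 3 => (pathVertex z i a b k 4, a)
  | 4 => (pathVertex z i a b k 4, b)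
  | 5 => (pathVertex z i a b k 6, k)

/-- The interior vertices of a path. -/
def pathInterior (z : Fin d → ℤ) (i a b k : Fin d) : Finset (Fin d → ℤ) :=
  {pathVertex z i a b k 1, pathVertex z i a b k 2, pathVertex z i a b k 3, pathVertex z i a b k 4,
    pathVertex z i a b k 5}

lemma card_pathInterior_le (z : Fin d → ℤ) (i a b k : Fin d) : (pathInterior z i a b k).card ≤ 5 :=
  Finset.card_le_five

/-- Coordinate `k` tells the interiors apart: it is raised throughout the interior of the `k`-th
path and never on that of another. -/
lemma disjoint_pathInterior (z : Fin d → ℤ) {i a b k k' : Fin d} (hk : k ≠ i ∧ k ≠ a ∧ k ≠ b)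
    (hkk : k ≠ k') : Disjoint (pathInterior z i a b k) (pathInterior z i a b k') := by
  have h1 : ∀ w ∈ pathInterior z i a b k, w k = z k + z k + 1 := by
    intro w hw
    simp only [pathInterior, pathVertex, Finset.mem_insert, Finset.mem_singleton] at hw
    rcases hw with rfl | rfl | rfl | rfl | rfl <;>
      simp [hk.1, hk.2.1, hk.2.2]
  have h2 : ∀ w ∈ pathInterior z i a b k', w k = z k + z k := by
    intro w hw
    simp only [pathInterior, pathVertex, Finset.mem_insert, Finset.mem_singleton] at hw
    rcases hw with rfl | rfl | rfl | rfl | rfl <;>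
      simp [hk.1, hk.2.1, hk.2.2, hkk]
  rw [Finset.disjoint_left]
  intro w hw hw'
  have := h1 w hw
  have := h2 w hw'
  omega

/-- There are many open hubs on both sides of the edge `(z, i)`, and many open paths between any
two hubs. -/
def ManyPaths (o : Set (Fin d → ℤ)) (z : Fin d → ℤ) (i : Fin d) : Prop :=
  ∀ S : Finset (Fin d), S.card ≤ 6 →
    (∃ k, k ∉ S ∧ z + z + basisVec k ∈ o) ∧
    (∃ k, k ∉ S ∧ z + basisVec i + (z + basisVec i) + basisVec k ∈ o) ∧
    ∀ a b, ∃ k, (k ∉ S ∧ k ≠ i ∧ k ≠ a ∧ k ≠ b) ∧ ∀ w ∈ pathInterior z i a b k, w ∈ o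

/-- The edges `q` and `q'` have no common endpoint. -/
def EdgesDisjoint (q q' : (Fin d → ℤ) × Fin d) : Prop :=
  q.1 ≠ q'.1 ∧ q.1 ≠ q'.1 + basisVec q'.2 ∧ q.1 + basisVec q.2 ≠ q'.1 ∧
    q.1 + basisVec q.2 ≠ q'.1 + basisVec q'.2

/-- Each vertex is twice `z` or twice `z + e_i` plus a vector with entries 0 and 1; the inequalities
keep basis vectors in that remainder from coinciding. -/
lemma isChild_pathVertex (z : Fin d → ℤ) {i a b k : Fin d} (ha : a ≠ i)
    (hk : k ≠ i ∧ k ≠ a ∧ k ≠ b) (s : Fin 7) : IsChild z i (pathVertex z i a b k s) := by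
  obtain ⟨h1, h2, h3⟩ := hk
  have key : ∀ t : Fin d → ℤ, (∀ c, t c = 0 ∨ t c = 1) → ∀ y : Fin d → ℤ, parent (y + y + t) = y := by
    intro t ht y
    funext c
    have := ht c
    simp only [parent, Pi.add_apply]
    omega
  have one : ∀ a : Fin d, ∀ c, basisVec a c = 0 ∨ basisVec a c = 1 := by
    intro a c
    simp only [Pi.single_apply]
    split_ifs <;> simp
  have two : ∀ a b : Fin d, a ≠ b → ∀ c, (basisVec a + basisVec b) c = 0 ∨
      (basisVec a + basisVec b) c = 1 := by
    intro a b hab c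
    simp only [Pi.add_apply, Pi.single_apply]
    split_ifs with h h' <;> simp_all
  have three : ∀ c, (basisVec a + basisVec k + basisVec i) c = 0 ∨
      (basisVec a + basisVec k + basisVec i) c = 1 := by
    intro c
    simp only [Pi.add_apply, Pi.single_apply]
    split_ifs with h h' h'' <;> simp_all
  fin_cases s
  · exact Or.inl (key _ (one a) z)
  · left
    have := key _ (two a k h2.symm) z
    simpa [pathVertex, add_assoc] using this
  · left
    have := key _ three z
    simpa [pathVertex, add_assoc] using this
  · right
    have := key _ (two a k h2.symm) (z + basisVec i)
    rw [← this]
    congr 1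
    simp only [pathVertex]
    abel
  · right
    have := key _ (one k) (z + basisVec i)
    rw [← this]
    congr 1
    simp only [pathVertex]
    abel
  · right
    have := key _ (two k b h3) (z + basisVec i)
    rw [← this]
    congr 1
    simp only [pathVertex]
    abel
  · exact Or.inr (key _ (one b) _)

/-- Edges are stored by their lower endpoint; the steps that remove `a` and `k` are traversed
downwards. -/
lemma pathEdge_eq (z : Fin d → ℤ) (i a b k : Fin d) (s : Fin 6) :
    ((pathEdge z i a b k s).1 = pathVertex z i a b k s.castSucc ∧
      (pathEdge z i a b k s).1 + basisVec (pathEdge z i a b k s).2 = pathVertex z i a b k s.succ) ∨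
    ((pathEdge z i a b k s).1 = pathVertex z i a b k s.succ ∧
      (pathEdge z i a b k s).1 + basisVec (pathEdge z i a b k s).2 =
        pathVertex z i a b k s.castSucc) := by
  fin_cases s <;> simp [pathEdge, pathVertex]
  · abel
  · abel

/-- If there are many open paths and any two bad edges on these paths have a common endpoint, then
the edge is good after coarsening. -/
theorem hubsLinked_of_manyPaths {o : Set (Fin d → ℤ)} {g : Set ((Fin d → ℤ) × Fin d)}
    {z : Fin d → ℤ} {i : Fin d} (hn : ManyPaths o z i)
    (hg : ∀ a b k s a' b' k' s', EdgesDisjoint (pathEdge z i a b k s) (pathEdge z i a' b' k' s') →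
      pathEdge z i a b k s ∈ g ∨ pathEdge z i a' b' k' s' ∈ g) :
    HubsLinked o g z i := by
  classical
  -- `x` and `y` are the endpoints of one bad edge, if any exists. Every bad edge on the paths meets
  -- that edge, so a path avoiding both points has only good edges.
  obtain ⟨x, y, hxy⟩ : ∃ x y : Fin d → ℤ, ∀ a b k s,
      (∀ t, pathVertex z i a b k t ≠ x ∧ pathVertex z i a b k t ≠ y) →
      pathEdge z i a b k s ∈ g := by
    by_cases h : ∃ a b k s, pathEdge z i a b k s ∉ g
    · obtain ⟨a, b, k, s, h⟩ := h
      refine ⟨(pathEdge z i a b k s).1,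
        (pathEdge z i a b k s).1 + basisVec (pathEdge z i a b k s).2, fun a' b' k' s' ht => ?_⟩
      refine (hg a b k s a' b' k' s' ?_).resolve_left h
      have e1 := ht s'.castSucc
      have e2 := ht s'.succ
      rcases pathEdge_eq z i a' b' k' s' with ⟨h1, h2⟩ | ⟨h1, h2⟩
      · rw [← h1] at e1
        rw [← h2] at e2
        exact ⟨e1.1.symm, e2.1.symm, e1.2.symm, e2.2.symm⟩
      · rw [← h1] at e2
        rw [← h2] at e1
        exact ⟨e2.1.symm, e1.1.symm, e2.2.symm, e1.2.symm⟩
    · push Not at h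
      exact ⟨0, 0, fun a b k s _ => h a b k s⟩
  have inj : ∀ (y₀ x₀ : Fin d → ℤ),
      (Finset.univ.filter fun a : Fin d => y₀ + y₀ + basisVec a = x₀).card ≤ 1 := by
    intro y₀ x₀
    refine Finset.card_le_one.2 fun a ha b hb => ?_
    simp only [Finset.mem_filter, Finset.mem_univ, true_and] at ha hb
    have h : basisVec a = basisVec b := add_left_cancel (ha.trans hb.symm)
    by_contra hab
    have := congrFun h a
    simp [hab] at this
  have maj : ∀ y₀ : Fin d → ℤ, (∀ S : Finset (Fin d), S.card ≤ 6 →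
      ∃ k, k ∉ S ∧ y₀ + y₀ + basisVec k ∈ o) → ∃ K ⊆ hubs o y₀,
      (hubs o y₀).card < 2 * K.card ∧
      ∀ a ∈ K, a ≠ i ∧ y₀ + y₀ + basisVec a ≠ x ∧ y₀ + y₀ + basisVec a ≠ y := by
    intro y₀ h
    have h7 : 7 ≤ (hubs o y₀).card := by
      by_contra hlt
      obtain ⟨k, hk, hko⟩ := h (hubs o y₀) (by omega)
      exact hk (mem_hubs.2 hko)
    -- At most three hubs are discarded out of at least seven, which leaves a majority. This is the
    -- origin of the 6 in `ManyPaths`.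
    let E : Finset (Fin d) := {i} ∪ (Finset.univ.filter fun a : Fin d => y₀ + y₀ + basisVec a = x) ∪
      (Finset.univ.filter fun a : Fin d => y₀ + y₀ + basisVec a = y)
    have hE : E.card ≤ 3 := by
      refine (Finset.card_union_le _ _).trans ?_
      have := Finset.card_union_le {i} (Finset.univ.filter fun a : Fin d => y₀ + y₀ + basisVec a = x)
      have := inj y₀ x
      have := inj y₀ y
      rw [Finset.card_singleton] at *
      omega
    refine ⟨hubs o y₀ \ E, Finset.sdiff_subset, ?_, ?_⟩
    · have := Finset.le_card_sdiff E (hubs o y₀)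
      omega
    · intro a ha
      simp only [E, Finset.mem_sdiff, Finset.mem_union, Finset.mem_singleton, Finset.mem_filter,
        Finset.mem_univ, true_and] at ha
      tauto
  obtain ⟨K, hK, hKc, hKp⟩ := maj z fun S hS => (hn S hS).1
  obtain ⟨K', hK', hKc', hKp'⟩ := maj (z + basisVec i) fun S hS => (hn S hS).2.1
  refine ⟨K, hK, K', hK', hKc, hKc', fun a ha b hb => ?_⟩
  -- Interiors being disjoint, each of `x` and `y` spoils at most one value of `k`.
  have cardS : ∀ x₀ : Fin d → ℤ, (Finset.univ.filter fun k : Fin d =>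
      (k ≠ i ∧ k ≠ a ∧ k ≠ b) ∧ x₀ ∈ pathInterior z i a b k).card ≤ 1 := by
    intro x₀
    refine Finset.card_le_one.2 fun k hk k' hk' => ?_
    simp only [Finset.mem_filter, Finset.mem_univ, true_and] at hk hk'
    by_contra hne
    exact Finset.disjoint_left.1 (disjoint_pathInterior z hk.1 hne) hk.2 hk'.2
  obtain ⟨k, ⟨hkS, hk⟩, hko⟩ := (hn ((Finset.univ.filter fun k : Fin d =>
      (k ≠ i ∧ k ≠ a ∧ k ≠ b) ∧ x ∈ pathInterior z i a b k) ∪ (Finset.univ.filter fun k : Fin d =>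
      (k ≠ i ∧ k ≠ a ∧ k ≠ b) ∧ y ∈ pathInterior z i a b k)) (by
        refine (Finset.card_union_le _ _).trans ?_
        have := cardS x
        have := cardS y
        omega)).2.2 a b
  simp only [Finset.mem_union, Finset.mem_filter, Finset.mem_univ, true_and] at hkS
  have hv : ∀ t, pathVertex z i a b k t ∈ o ∧ pathVertex z i a b k t ≠ x ∧
      pathVertex z i a b k t ≠ y := by
    have hint : ∀ w ∈ pathInterior z i a b k, w ∈ o ∧ w ≠ x ∧ w ≠ y := by
      intro w hw
      refine ⟨hko w hw, ?_, ?_⟩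
      · rintro rfl; exact hkS (Or.inl ⟨hk, hw⟩)
      · rintro rfl; exact hkS (Or.inr ⟨hk, hw⟩)
    intro t
    fin_cases t
    · exact ⟨mem_hubs.1 (hK ha), (hKp a ha).2⟩
    · exact hint _ (by simp [pathInterior])
    · exact hint _ (by simp [pathInterior])
    · exact hint _ (by simp [pathInterior])
    · exact hint _ (by simp [pathInterior])
    · exact hint _ (by simp [pathInterior])
    · exact ⟨mem_hubs.1 (hK' hb), (hKp' b hb).2⟩
  have hstep : ∀ s : Fin 6, Link o g (pathVertex z i a b k s.castSucc) (pathVertex z i a b k s.succ) ∧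
      IsChild z i (pathVertex z i a b k s.castSucc) ∧ IsChild z i (pathVertex z i a b k s.succ) := by
    intro s
    refine ⟨⟨(hv _).1, (hv _).1, (pathEdge z i a b k s).2, ?_⟩,
      isChild_pathVertex z (hKp a ha).1 hk _,
      isChild_pathVertex z (hKp a ha).1 hk _⟩
    have hmem := hxy a b k s fun t => (hv t).2
    rcases pathEdge_eq z i a b k s with ⟨h1, h2⟩ | ⟨h1, h2⟩
    · left
      rw [← h1, ← h2]
      exact ⟨rfl, hmem⟩
    · right
      rw [← h1, ← h2]
      exact ⟨rfl, hmem⟩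
  change ReflTransGen _ (pathVertex z i a b k 0) (pathVertex z i a b k 6)
  exact .tail (.tail (.tail (.tail (.tail (.tail .refl (hstep 0)) (hstep 1)) (hstep 2)) (hstep 3))
    (hstep 4)) (hstep 5)

/-- A choice of one hub for every box, compatible with links: hubs of linked boxes are connected by
chains of links between nearby boxes. -/
theorem exists_hub {o o' : Set (Fin d → ℤ)} {g g' : Set ((Fin d → ℤ) × Fin d)}
    (h : ∀ z i, z ∈ o' → z + basisVec i ∈ o' → (z, i) ∈ g' → (z, i) ∈ coarsen o g) :
    ∃ hub : (Fin d → ℤ) → (Fin d → ℤ), (∀ z, parent (hub z) = z) ∧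
      (∀ z z', Link o' g' z z' → (∃ a, hub z = z + z + basisVec a) ∧
        (∃ w, Link o g (hub z) w) ∧
        ReflTransGen (fun w w' => Link o g w w' ∧ (∀ c, |parent w c - z c| ≤ 2) ∧
          ∀ c, |parent w' c - z c| ≤ 2) (hub z) (hub z')) := by
  classical
  have sym : ∀ (P : (Fin d → ℤ) → Prop) x y,
      ReflTransGen (fun w w' => Link o g w w' ∧ P w ∧ P w') x y →
      ReflTransGen (fun w w' => Link o g w w' ∧ P w ∧ P w') y x := by
    intro P x y hxy
    have : Std.Symm fun w w' => Link o g w w' ∧ P w ∧ P w' :=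
      ⟨fun _ _ hw => ⟨hw.1.symm, hw.2.2, hw.2.1⟩⟩
    exact ReflTransGen.stdSymm.symm _ _ hxy
  have key : ∀ z z', Link o' g' z z' → ∃ K ⊆ hubs o z, ∃ K' ⊆ hubs o z',
      (hubs o z).card < 2 * K.card ∧ (hubs o z').card < 2 * K'.card ∧
      ∀ a ∈ K, ∀ b ∈ K', ReflTransGen (fun w w' => Link o g w w' ∧
        (parent w = z ∨ parent w = z') ∧ (parent w' = z ∨ parent w' = z'))
        (z + z + basisVec a) (z' + z' + basisVec b) := by
    rintro z z' ⟨hz, hz', k, ⟨rfl, hk⟩ | ⟨rfl, hk⟩⟩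
    · exact h z k hz hz' hk
    · obtain ⟨K, hK, K', hK', hc, hc', hp⟩ := h z' k hz' hz hk
      refine ⟨K', hK', K, hK, hc', hc, fun a ha b hb => ?_⟩
      refine ReflTransGen.mono ?_ _ _ (sym _ _ _ (hp b hb a ha))
      exact fun _ _ hw => ⟨hw.1, hw.2.1.symm, hw.2.2.symm⟩
  choose! K hK K' hK' hc hc' hp using key
  have hne : ∀ z z', Link o' g' z z' → (K z z').Nonempty ∧ (K' z z').Nonempty := by
    intro z z' hl
    have := hc z z' hl
    have := hc' z z' hl
    constructor <;> rw [← Finset.card_pos] <;> omega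
  have hinter : ∀ (H A B : Finset (Fin d)), A ⊆ H → B ⊆ H → H.card < 2 * A.card →
      H.card < 2 * B.card → ∃ a, a ∈ A ∧ a ∈ B := by
    intro H A B hA hB h1 h2
    by_contra hcon
    push Not at hcon
    have := Finset.card_union_of_disjoint (Finset.disjoint_left.2 hcon)
    have := Finset.card_le_card (Finset.union_subset hA hB)
    omega
  -- Each linked box gets a reference neighbour `nb z`; its hub `α z` is taken from the majority
  -- facing that neighbour.
  have hex : ∀ z, (∃ z', Link o' g' z z') → ∃ y, Link o' g' z y ∧ ∃ a, a ∈ K z y := by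
    rintro z ⟨z', hl⟩
    exact ⟨z', hl, (hne z z' hl).1⟩
  choose! nb hnb hα using hex
  choose α hα using hα
  have hdist : ∀ z z', Link o' g' z z' → ∀ c, |z' c - z c| ≤ 1 := by
    rintro z z' ⟨-, -, k, ⟨rfl, -⟩ | ⟨rfl, -⟩⟩ c <;>
    · simp only [Pi.add_apply, Pi.single_apply]
      split_ifs <;> simp
  -- The majorities facing `nb z` and `z'` share a hub `a`. It is joined to `α z` by way of any
  -- majority hub of `nb z`.
  have hjoin : ∀ z z' (hl : Link o' g' z z'), ∃ a ∈ K z z',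
      ReflTransGen (fun w w' => Link o g w w' ∧ (parent w = z ∨ parent w = nb z) ∧
        (parent w' = z ∨ parent w' = nb z)) (z + z + basisVec (α z ⟨z', hl⟩)) (z + z + basisVec a) := by
    intro z z' hl
    have hn := hnb z ⟨z', hl⟩
    obtain ⟨a, ha, ha'⟩ := hinter _ _ _ (hK _ _ hn) (hK _ _ hl) (hc _ _ hn) (hc _ _ hl)
    obtain ⟨b, hb⟩ := (hne _ _ hn).2
    exact ⟨a, ha', (hp _ _ hn _ (hα z ⟨z', hl⟩) b hb).trans (sym _ _ _ (hp _ _ hn a ha b hb))⟩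
  -- The default `z + z` makes the hub a child of its box even where there is no link.
  refine ⟨fun z => if e : ∃ z', Link o' g' z z' then z + z + basisVec (α z e) else z + z, ?_, ?_⟩
  · intro z
    dsimp only
    split_ifs
    · exact parent_child _ _
    · exact parent_double _
  · intro z z' hl
    have e1 : ∃ y, Link o' g' z y := ⟨z', hl⟩
    have e2 : ∃ y, Link o' g' z' y := ⟨z, hl.symm⟩
    simp only [dif_pos e1, dif_pos e2]
    refine ⟨⟨_, rfl⟩, ?_, ?_⟩
    · obtain ⟨b, hb⟩ := (hne _ _ (hnb z e1)).2
      -- The chain towards `nb z` cannot be trivial, since its ends have different parents; its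
      -- first link shows that the hub is itself linked.
      rcases ReflTransGen.cases_head (hp _ _ (hnb z e1) _ (hα z e1) b hb) with heq | ⟨w, hw, -⟩
      · exfalso
        have h3 := congrArg parent heq
        rw [parent_child, parent_child] at h3
        obtain ⟨-, -, k, ⟨h4, -⟩ | ⟨h4, -⟩⟩ := hnb z e1 <;>
        · have h5 := congrFun h4 k
          rw [← h3] at h5
          simp at h5
      · exact ⟨w, hw.1⟩
    · obtain ⟨a, ha, hap⟩ := hjoin z z' hl
      obtain ⟨b, hb, hbp⟩ := hjoin z' z hl.symm
      have near : ∀ y y' : Fin d → ℤ, (∀ c, |y c - z c| ≤ 2) → (∀ c, |y' c - z c| ≤ 2) → ∀ u v,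
          ReflTransGen (fun w w' => Link o g w w' ∧ (parent w = y ∨ parent w = y') ∧
            (parent w' = y ∨ parent w' = y')) u v →
          ReflTransGen (fun w w' => Link o g w w' ∧ (∀ c, |parent w c - z c| ≤ 2) ∧
            ∀ c, |parent w' c - z c| ≤ 2) u v := by
        intro y y' hy hy' u v huv
        refine ReflTransGen.mono ?_ _ _ huv
        rintro w w' ⟨h1, h2, h3⟩
        refine ⟨h1, ?_, ?_⟩
        · rcases h2 with h2 | h2 <;> rw [h2] <;> assumption
        · rcases h3 with h3 | h3 <;> rw [h3] <;> assumption
      have d0 : ∀ c, |z c - z c| ≤ 2 := by simp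
      have d1 : ∀ c, |nb z c - z c| ≤ 2 := fun c => (hdist _ _ (hnb z e1) c).trans (by norm_num)
      have d2 : ∀ c, |z' c - z c| ≤ 2 := fun c => (hdist _ _ hl c).trans (by norm_num)
      have d3 : ∀ c, |nb z' c - z c| ≤ 2 := by
        intro c
        have := hdist _ _ hl c
        have := hdist _ _ (hnb z' e2) c
        rw [abs_le] at *
        omega
      -- `b₁` lies in both majorities of `z'` facing `z`, one from each orientation of the link. The
      -- chain runs from `α z` to `a`, `b₁`, `a₁`, `b` and then to `α z'`.
      obtain ⟨b₁, hb₁, hb₁'⟩ := hinter _ _ _ (hK _ _ hl.symm) (hK' _ _ hl) (hc _ _ hl.symm)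
        (hc' _ _ hl)
      obtain ⟨a₁, ha₁⟩ := (hne _ _ hl.symm).2
      have p1 := near _ _ d0 d1 _ _ hap
      have p2 := near _ _ d0 d2 _ _ (hp _ _ hl a ha b₁ hb₁')
      have p3 := near _ _ d2 d0 _ _ ((hp _ _ hl.symm b₁ hb₁ a₁ ha₁).trans
        (sym _ _ _ (hp _ _ hl.symm b hb a₁ ha₁)))
      have p4 := near _ _ d2 d3 _ _ (sym _ _ _ hbp)
      exact ((p1.trans p2).trans p3).trans p4

end FractalPercolation

/-! ### Independent coins and the probability of many open paths -/

namespace FractalPercolation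

open ProbabilityTheory

variable {d : ℕ}

instance (p : I) : IsProbabilityMeasure (law d p) := by
  unfold law
  infer_instance

/-- The σ-algebra generated by the coins in `S`. -/
abbrev coinsOn (S : Set (BoxIndex d)) : MeasurableSpace (Config d) :=
  ⨆ b ∈ S, MeasurableSpace.comap (fun ω : Config d => ω b) ⊤

lemma coinsOn_mono {S T : Set (BoxIndex d)} (h : S ⊆ T) : coinsOn S ≤ coinsOn T :=
  biSup_mono fun _ hb => h hb

lemma comap_coin_le (b : BoxIndex d) :
    MeasurableSpace.comap (fun ω : Config d => ω b) ⊤ ≤ MeasurableSpace.pi :=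
  (measurable_pi_apply b).comap_le

lemma coinsOn_le (S : Set (BoxIndex d)) : coinsOn S ≤ MeasurableSpace.pi :=
  iSup₂_le fun b _ => comap_coin_le b

lemma measurableSet_coin {S : Set (BoxIndex d)} {b : BoxIndex d} (hb : b ∈ S) :
    MeasurableSet[coinsOn S] {ω : Config d | ω b = true} := by
  have h : MeasurableSpace.comap (fun ω : Config d => ω b) ⊤ ≤ coinsOn S :=
    le_iSup₂ (f := fun b (_ : b ∈ S) => MeasurableSpace.comap (fun ω : Config d => ω b) ⊤) b hb
  exact h _ ⟨{true}, trivial, rfl⟩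

/-- Events depending on disjoint sets of coins are independent. -/
lemma measureReal_inter_of_disjoint (p : I) {S T : Set (BoxIndex d)} (hST : Disjoint S T)
    {A B : Set (Config d)} (hA : MeasurableSet[coinsOn S] A) (hB : MeasurableSet[coinsOn T] B) :
    (law d p).real (A ∩ B) = (law d p).real A * (law d p).real B := by
  have h1 : iIndepFun (fun (b : BoxIndex d) (ω : Config d) => ω b) (law d p) :=
    iIndepFun_infinitePi (P := fun _ : BoxIndex d => bernoulliMeasure true false p)
      (X := fun _ x => x) fun _ => measurable_id
  have h2 : Indep (coinsOn S) (coinsOn T) (law d p) :=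
    indep_iSup_of_disjoint comap_coin_le h1 hST
  have h3 := (Indep_iff _ _ _).1 h2 A B hA hB
  simp [measureReal_def, h3, ENNReal.toReal_mul]

lemma measureReal_coin (p : I) (b : BoxIndex d) :
    (law d p).real {ω | ω b = true} = p := by
  have h : (law d p).map (fun ω => ω b) = bernoulliMeasure true false p :=
    Measure.infinitePi_map_eval (fun _ : BoxIndex d => bernoulliMeasure true false p) b
  have h2 : (law d p).real {ω | ω b = true} = ((law d p).map (fun ω => ω b)).real {true} := by
    rw [map_measureReal_apply (measurable_pi_apply b) (measurableSet_singleton _)]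
    rfl
  rw [h2, h, bernoulliMeasure_real_apply p (measurableSet_singleton _)]
  simp

lemma measurableSet_forall_coin {S : Set (BoxIndex d)} (T : Finset (BoxIndex d)) (hT : ↑T ⊆ S) :
    MeasurableSet[coinsOn S] {ω : Config d | ∀ b ∈ T, ω b = true} := by
  have : {ω : Config d | ∀ b ∈ T, ω b = true} = ⋂ b ∈ T, {ω : Config d | ω b = true} := by
    ext ω; simp
  rw [this]
  let _ := coinsOn S
  exact Finset.measurableSet_biInter T fun b hb => measurableSet_coin (hT hb)

lemma measureReal_forall_coin (p : I) (T : Finset (BoxIndex d)) :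
    (law d p).real {ω | ∀ b ∈ T, ω b = true} = (p : ℝ) ^ T.card := by
  classical
  induction T using Finset.induction_on with
  | empty => simp
  | insert b T hb ih =>
    have h1 : {ω : Config d | ∀ c ∈ insert b T, ω c = true} =
        {ω | ω b = true} ∩ {ω | ∀ c ∈ T, ω c = true} := by
      ext ω; simp
    rw [h1, measureReal_inter_of_disjoint p (S := {b}) (T := ↑T) (by simpa using hb)
      (measurableSet_coin rfl) (measurableSet_forall_coin T subset_rfl), ih, measureReal_coin,
      Finset.card_insert_of_notMem hb, pow_succ']

/-- The probability that none of finitely many disjoint small sets of coins shows only "keep". -/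
lemma measureReal_forall_not_le (p : I) {ι : Type*} [DecidableEq ι] (T : ι → Finset (BoxIndex d))
    (m : ℕ) (hT : ∀ k, (T k).card ≤ m) (J : Finset ι)
    (hd : ∀ k ∈ J, ∀ k' ∈ J, k ≠ k' → Disjoint (T k) (T k')) :
    (law d p).real {ω | ∀ k ∈ J, ¬ ∀ b ∈ T k, ω b = true} ≤ (1 - (p : ℝ) ^ m) ^ J.card := by
  have hp0 : (0 : ℝ) ≤ p := p.2.1
  have hp1 : (p : ℝ) ≤ 1 := p.2.2
  induction J using Finset.induction_on with
  | empty => simp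
  | insert k J hk ih =>
    have h1 : {ω : Config d | ∀ l ∈ insert k J, ¬ ∀ b ∈ T l, ω b = true} =
        {ω | ∀ b ∈ T k, ω b = true}ᶜ ∩ {ω | ∀ l ∈ J, ¬ ∀ b ∈ T l, ω b = true} := by
      ext ω; simp
    have hJ : MeasurableSet[coinsOn (⋃ l ∈ J, (T l : Set (BoxIndex d)))]
        {ω : Config d | ∀ l ∈ J, ¬ ∀ b ∈ T l, ω b = true} := by
      have : {ω : Config d | ∀ l ∈ J, ¬ ∀ b ∈ T l, ω b = true} =
          ⋂ l ∈ J, {ω : Config d | ∀ b ∈ T l, ω b = true}ᶜ := by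
        ext ω; simp
      rw [this]
      let _ := coinsOn (⋃ l ∈ J, (T l : Set (BoxIndex d)))
      exact Finset.measurableSet_biInter J fun l hl => (measurableSet_forall_coin (T l)
        (Set.subset_biUnion_of_mem (u := fun l => (T l : Set (BoxIndex d))) hl)).compl
    have hkm : MeasurableSet[coinsOn (T k : Set (BoxIndex d))]
        {ω : Config d | ∀ b ∈ T k, ω b = true}ᶜ :=
      @MeasurableSet.compl _ _ (coinsOn _) (measurableSet_forall_coin (T k) subset_rfl)
    have hdis : Disjoint (T k : Set (BoxIndex d)) (⋃ l ∈ J, (T l : Set (BoxIndex d))) := by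
      rw [Set.disjoint_iUnion₂_right]
      intro l hl
      rw [Finset.disjoint_coe]
      exact hd k (Finset.mem_insert_self _ _) l (Finset.mem_insert_of_mem hl)
        fun h => hk (h ▸ hl)
    rw [h1, measureReal_inter_of_disjoint p hdis hkm hJ, Finset.card_insert_of_notMem hk, pow_succ']
    have h2 : (law d p).real {ω | ∀ b ∈ T k, ω b = true}ᶜ ≤ 1 - (p : ℝ) ^ m := by
      rw [probReal_compl_eq_one_sub (coinsOn_le _ _ (measurableSet_forall_coin (T k) subset_rfl)),
        measureReal_forall_coin]
      have := pow_le_pow_of_le_one hp0 hp1 (hT k)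
      linarith
    have h3 : (0 : ℝ) ≤ 1 - (p : ℝ) ^ m := by
      have := pow_le_one₀ (n := m) hp0 hp1
      linarith
    refine mul_le_mul h2 (ih ?_) measureReal_nonneg h3
    exact fun l hl l' hl' => hd l (Finset.mem_insert_of_mem hl) l' (Finset.mem_insert_of_mem hl')

/-- The boxes of scale `j` whose coin shows "keep". -/
def openAt (j : ℕ) (ω : Config d) : Set (Fin d → ℤ) := {w | ω (j, w) = true}

/-- A bound for the probability that there are few open paths. -/
noncomputable def pathError (d : ℕ) (p : I) : ℝ :=
  d ^ 6 * ((d ^ 2 + 2) * (1 - (p : ℝ) ^ 5) ^ (d - 9))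

lemma pathError_nonneg (d : ℕ) (p : I) : 0 ≤ pathError d p := by
  have := pow_le_one₀ (n := 5) p.2.1 p.2.2
  have : (0 : ℝ) ≤ 1 - (p : ℝ) ^ 5 := by linarith
  unfold pathError
  positivity

/-- A union bound over the forbidden set `S` and over `d ^ 2 + 2` failures: one for each pair of
hubs and one for the hubs on each side. At least `d - 9` disjoint trials remain after excluding `S`,
`i`, `a` and `b`. -/
lemma measureReal_not_manyPaths_le (p : I) (hd : 6 ≤ d) (j : ℕ) (z : Fin d → ℤ) (i : Fin d) :
    (law d p).real {ω | ¬ ManyPaths (openAt j ω) z i} ≤ pathError d p := by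
  classical
  have hq0 : (0 : ℝ) ≤ 1 - (p : ℝ) ^ 5 := by
    have := pow_le_one₀ (n := 5) p.2.1 p.2.2
    linarith
  have hq1 : 1 - (p : ℝ) ^ 5 ≤ 1 := by
    have := pow_nonneg p.2.1 5
    linarith
  let T : Finset (Fin d) → (Fin d × Fin d) ⊕ Bool → Set (Config d) := fun S t => match t with
    | .inl q => {ω | ∀ k ∈ Finset.univ \ (S ∪ {i, q.1, q.2}),
        ¬ ∀ b ∈ (pathInterior z i q.1 q.2 k).map ⟨Prod.mk j, Prod.mk_right_injective j⟩, ω b = true}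
    | .inr s => {ω | ∀ k ∈ Finset.univ \ S, ¬ ∀ b ∈ ({(j, cond s (z + z + basisVec k)
        (z + basisVec i + (z + basisVec i) + basisVec k))} : Finset (BoxIndex d)), ω b = true}
  have hsub : {ω | ¬ ManyPaths (openAt j ω) z i} ⊆
      ⋃ S ∈ Finset.powersetCard 6 (Finset.univ : Finset (Fin d)), ⋃ t, T S t := by
    intro ω hω
    simp only [ManyPaths, Set.mem_ofPred_eq, not_forall] at hω
    obtain ⟨S, hS, hω⟩ := hω
    -- Enlarging `S` to exactly six elements leaves at most `d ^ 6` sets in the union bound.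
    obtain ⟨S', hSS', -, hS'⟩ := Finset.exists_subsuperset_card_eq (Finset.subset_univ S) hS
      (by simpa using hd)
    simp only [Set.mem_iUnion]
    refine ⟨S', by simp [hS'], ?_⟩
    by_contra hcon
    push Not at hcon
    apply hω
    refine ⟨?_, ?_, fun a b => ?_⟩
    · have := hcon (.inr true)
      simp only [T, Set.mem_ofPred_eq, not_forall] at this
      obtain ⟨k, hk, h⟩ := this
      push Not at h
      refine ⟨k, fun hkS => ?_, ?_⟩
      · simp [hSS' hkS] at hk
      · simpa [openAt] using h
    · have := hcon (.inr false)
      simp only [T, Set.mem_ofPred_eq, not_forall] at this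
      obtain ⟨k, hk, h⟩ := this
      push Not at h
      refine ⟨k, fun hkS => ?_, ?_⟩
      · simp [hSS' hkS] at hk
      · simpa [openAt] using h
    · have := hcon (.inl (a, b))
      simp only [T, Set.mem_ofPred_eq, not_forall] at this
      obtain ⟨k, hk, h⟩ := this
      push Not at h
      simp only [Finset.mem_sdiff, Finset.mem_univ, true_and, Finset.mem_union, Finset.mem_insert,
        Finset.mem_singleton, not_or] at hk
      refine ⟨k, ⟨fun hkS => hk.1 (hSS' hkS), hk.2⟩, fun w hw => ?_⟩
      exact h (j, w) (Finset.mem_map_of_mem _ hw)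
  have hT : ∀ S ∈ Finset.powersetCard 6 (Finset.univ : Finset (Fin d)), ∀ t,
      (law d p).real (T S t) ≤ (1 - (p : ℝ) ^ 5) ^ (d - 9) := by
    intro S hS t
    have hS6 : S.card = 6 := (Finset.mem_powersetCard.1 hS).2
    rcases t with ⟨a, b⟩ | s
    · refine (measureReal_forall_not_le p (fun k => (pathInterior z i a b k).map
        ⟨Prod.mk j, Prod.mk_right_injective j⟩) 5
        (fun k => by simpa using card_pathInterior_le z i a b k) _ ?_).trans
        (pow_le_pow_of_le_one hq0 hq1 ?_)
      · intro k hk k' _ hkk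
        simp only [Finset.mem_sdiff, Finset.mem_univ, true_and, Finset.mem_union, Finset.mem_insert,
          Finset.mem_singleton, not_or] at hk
        exact (Finset.disjoint_map _).2 (disjoint_pathInterior z hk.2 hkk)
      · have h1 := Finset.le_card_sdiff (S ∪ {i, a, b}) Finset.univ
        have h2 := Finset.card_union_le S {i, a, b}
        have h3 : ({i, a, b} : Finset (Fin d)).card ≤ 3 := Finset.card_le_three
        rw [Finset.card_univ, Fintype.card_fin] at h1
        dsimp only
        omega
    · refine (measureReal_forall_not_le p (fun k => ({(j, cond s (z + z + basisVec k)
        (z + basisVec i + (z + basisVec i) + basisVec k))} : Finset (BoxIndex d))) 5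
        (fun k => by simp) _ ?_).trans (pow_le_pow_of_le_one hq0 hq1 ?_)
      · intro k _ k' _ hkk
        have hne : (basisVec k : Fin d → ℤ) ≠ basisVec k' := by
          intro h
          have := congrFun h k
          simp [hkk] at this
        cases s <;> simpa using hne
      · have h1 := Finset.le_card_sdiff S Finset.univ
        rw [Finset.card_univ, Fintype.card_fin] at h1
        omega
  calc (law d p).real {ω | ¬ ManyPaths (openAt j ω) z i}
      ≤ (law d p).real (⋃ S ∈ Finset.powersetCard 6 (Finset.univ : Finset (Fin d)), ⋃ t, T S t) :=
        measureReal_mono hsub (measure_ne_top _ _)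
    _ ≤ ∑ S ∈ Finset.powersetCard 6 (Finset.univ : Finset (Fin d)), (law d p).real (⋃ t, T S t) :=
        measureReal_biUnion_finset_le _ _
    _ ≤ ∑ S ∈ Finset.powersetCard 6 (Finset.univ : Finset (Fin d)),
          ((d ^ 2 + 2) * (1 - (p : ℝ) ^ 5) ^ (d - 9)) := by
        refine Finset.sum_le_sum fun S hS => ?_
        refine (measureReal_iUnion_fintype_le _).trans ?_
        refine (Finset.sum_le_sum fun t _ => hT S hS t).trans_eq ?_
        simp [sq]
    _ ≤ pathError d p := by
        rw [Finset.sum_const, Finset.card_powersetCard, Finset.card_univ, Fintype.card_fin,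
          nsmul_eq_mul, pathError]
        have : ((d.choose 6 : ℕ) : ℝ) ≤ (d : ℝ) ^ 6 := by exact_mod_cast Nat.choose_le_pow d 6
        gcongr

/-! ### Locality of edge states and the recursive estimate -/

/-- For every site `z`, its state depends on the coins in `D z` only. -/
def SiteAdapted (D : (Fin d → ℤ) → Set (BoxIndex d)) (o : Config d → Set (Fin d → ℤ)) : Prop :=
  ∀ z, MeasurableSet[coinsOn (D z)] {ω | z ∈ o ω}

/-- For every edge, its state depends on the coins attached to the two endpoints only. -/
def EdgeAdapted (D : (Fin d → ℤ) → Set (BoxIndex d)) (g : Config d → Set ((Fin d → ℤ) × Fin d)) :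
    Prop :=
  ∀ z i, MeasurableSet[coinsOn (D z ∪ D (z + basisVec i))] {ω | (z, i) ∈ g ω}

/-- The coins attached to the children of a site. -/
def coarsenCoins (D : (Fin d → ℤ) → Set (BoxIndex d)) (z : Fin d → ℤ) : Set (BoxIndex d) :=
  ⋃ w, ⋃ (_ : parent w = z), D w

lemma pairwise_disjoint_coarsenCoins {D : (Fin d → ℤ) → Set (BoxIndex d)}
    (hD : Pairwise (Function.onFun Disjoint D)) :
    Pairwise (Function.onFun Disjoint (coarsenCoins D)) := by
  intro z z' hzz
  simp only [Function.onFun, coarsenCoins, Set.disjoint_iUnion_left, Set.disjoint_iUnion_right]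
  rintro w rfl w' rfl
  exact hD fun h => hzz (h ▸ rfl)

lemma EdgeAdapted.mono {D D' : (Fin d → ℤ) → Set (BoxIndex d)}
    {g : Config d → Set ((Fin d → ℤ) × Fin d)} (h : EdgeAdapted D g) (hD : ∀ z, D z ⊆ D' z) :
    EdgeAdapted D' g :=
  fun z i => coinsOn_mono (Set.union_subset_union (hD _) (hD _)) _ (h z i)

lemma EdgeAdapted.iInter {D : (Fin d → ℤ) → Set (BoxIndex d)}
    {g : ℕ → Config d → Set ((Fin d → ℤ) × Fin d)} (h : ∀ n, EdgeAdapted D (g n)) :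
    EdgeAdapted D fun ω => ⋂ n, g n ω := by
  intro z i
  have : {ω | (z, i) ∈ ⋂ n, g n ω} = ⋂ n, {ω | (z, i) ∈ g n ω} := by
    ext ω; simp
  rw [this]
  exact @MeasurableSet.iInter _ _ (coinsOn _) _ _ fun n => h n z i

/-- By locality the event is a function of finitely many site and edge states, and every subset of a
finite product of copies of `Prop` is measurable. -/
lemma EdgeAdapted.coarsen {D : (Fin d → ℤ) → Set (BoxIndex d)} {o : Config d → Set (Fin d → ℤ)}
    {g : Config d → Set ((Fin d → ℤ) × Fin d)} (ho : SiteAdapted D o) (hg : EdgeAdapted D g) :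
    EdgeAdapted (coarsenCoins D) fun ω => coarsen (o ω) (g ω) := by
  intro z i
  let m := coinsOn (coarsenCoins D z ∪ coarsenCoins D (z + basisVec i))
  have hD : ∀ w, IsChild z i w → D w ⊆ coarsenCoins D z ∪ coarsenCoins D (z + basisVec i) := by
    rintro w (h | h)
    · exact (Set.subset_iUnion₂ (s := fun w (_ : parent w = z) => D w) w h).trans
        Set.subset_union_left
    · exact (Set.subset_iUnion₂ (s := fun w (_ : parent w = z + basisVec i) => D w) w h).trans
        Set.subset_union_right
  have : Finite {w // IsChild z i w} := finite_isChild z i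
  let ι := {w // IsChild z i w} ⊕
    {q : {w // IsChild z i w} × Fin d // IsChild z i (q.1.1 + basisVec q.2)}
  let Φ : (ι → Prop) → Prop := fun f => HubsLinked {w | ∃ h, f (.inl ⟨w, h⟩)}
    {q | ∃ h h', f (.inr ⟨(⟨q.1, h⟩, q.2), h'⟩)} z i
  let s : Config d → ι → Prop := fun ω t => match t with
    | .inl w => w.1 ∈ o ω
    | .inr q => (q.1.1.1, q.1.2) ∈ g ω
  have hs : Measurable[m] s := by
    rw [measurable_pi_iff]
    rintro (⟨w, hw⟩ | ⟨⟨⟨w, hw⟩, k⟩, hk⟩)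
    · exact measurableSet_setOfPred.1 (coinsOn_mono (hD w hw) _ (ho w))
    · exact measurableSet_setOfPred.1
        (coinsOn_mono (Set.union_subset (hD w hw) (hD _ hk)) _ (hg w k))
  have heq : {ω | (z, i) ∈ FractalPercolation.coarsen (o ω) (g ω)} = s ⁻¹' {f | Φ f} := by
    ext ω
    constructor
    · refine HubsLinked.mono ?_ ?_
      · exact fun w hw => ⟨fun h => ⟨hw, h⟩, fun ⟨_, h⟩ => h⟩
      · exact fun w k hw hk h => ⟨hw, hk, h⟩
    · refine HubsLinked.mono ?_ ?_
      · exact fun w hw => ⟨fun ⟨_, h⟩ => h, fun h => ⟨hw, h⟩⟩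
      · exact fun w k hw hk ⟨_, _, h⟩ => h
  rw [heq]
  exact hs (Set.toFinite _).measurableSet

/-- The recursive estimate for the probability that an edge is bad after coarsening. -/
lemma measureReal_notMem_coarsen_le (p : I) {D : (Fin d → ℤ) → Set (BoxIndex d)}
    (hD : Pairwise (Function.onFun Disjoint D)) {o : Config d → Set (Fin d → ℤ)}
    {g : Config d → Set ((Fin d → ℤ) × Fin d)} (hg : EdgeAdapted D g) {η δ : ℝ} (z : Fin d → ℤ)
    (i : Fin d) (hη : (law d p).real {ω | ¬ ManyPaths (o ω) z i} ≤ η)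
    (hδ : ∀ w k, (law d p).real {ω | (w, k) ∉ g ω} ≤ δ) :
    (law d p).real {ω | (z, i) ∉ coarsen (o ω) (g ω)} ≤ η + (6 * d ^ 3) ^ 2 * δ ^ 2 := by
  classical
  let κ := Fin d × Fin d × Fin d × Fin 6
  let E : κ → (Fin d → ℤ) × Fin d := fun t => pathEdge z i t.1 t.2.1 t.2.2.1 t.2.2.2
  -- Only disjoint pairs count: edges with a common endpoint share coins and need not be
  -- independent.
  let B : κ × κ → Set (Config d) := fun t =>
    if EdgesDisjoint (E t.1) (E t.2) then {ω | E t.1 ∉ g ω} ∩ {ω | E t.2 ∉ g ω} else ∅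
  have hδ0 : 0 ≤ δ := measureReal_nonneg.trans (hδ 0 i)
  have hB : ∀ t, (law d p).real (B t) ≤ δ ^ 2 := by
    intro t
    simp only [B]
    split_ifs with h
    · obtain ⟨h1, h2, h3, h4⟩ := h
      have hm : ∀ q : (Fin d → ℤ) × Fin d, MeasurableSet[coinsOn (D q.1 ∪ D (q.1 + basisVec q.2))]
          {ω | q ∉ g ω} := fun q => @MeasurableSet.compl _ _ (coinsOn _) (hg q.1 q.2)
      rw [measureReal_inter_of_disjoint p
        (S := D (E t.1).1 ∪ D ((E t.1).1 + basisVec (E t.1).2))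
        (T := D (E t.2).1 ∪ D ((E t.2).1 + basisVec (E t.2).2)) ?_ (hm _) (hm _), sq]
      · exact mul_le_mul (hδ _ _) (hδ _ _) measureReal_nonneg hδ0
      · simp only [Set.disjoint_union_left, Set.disjoint_union_right]
        exact ⟨⟨hD h1, hD h3⟩, ⟨hD h2, hD h4⟩⟩
    · simpa using sq_nonneg δ
  have hsub : {ω | (z, i) ∉ coarsen (o ω) (g ω)} ⊆ {ω | ¬ ManyPaths (o ω) z i} ∪ ⋃ t, B t := by
    intro ω hω
    by_contra hcon
    simp only [Set.mem_union, Set.mem_ofPred_eq, Set.mem_iUnion, not_or, not_not, not_exists] at hcon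
    refine hω (hubsLinked_of_manyPaths hcon.1 fun a b k s a' b' k' s' hdis => ?_)
    have := hcon.2 ((a, b, k, s), (a', b', k', s'))
    by_contra hno
    push Not at hno
    apply this
    simp only [B, E, if_pos hdis]
    exact hno
  calc (law d p).real {ω | (z, i) ∉ coarsen (o ω) (g ω)}
      ≤ (law d p).real {ω | ¬ ManyPaths (o ω) z i} + (law d p).real (⋃ t, B t) :=
        (measureReal_mono hsub).trans (measureReal_union_le _ _)
    _ ≤ η + ∑ _t : κ × κ, δ ^ 2 :=
        add_le_add hη ((measureReal_iUnion_fintype_le _).trans (Finset.sum_le_sum fun t _ => hB t))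
    _ = η + (6 * d ^ 3) ^ 2 * δ ^ 2 := by
        rw [Finset.sum_const, nsmul_eq_mul, Finset.card_univ]
        simp only [κ, Fintype.card_prod, Fintype.card_fin]
        push_cast
        ring

/-! ### Good edges at all scales, below and above the unit boxes -/

/-- The coins of the descendants of the box of index `z` and scale `j`, including itself. -/
def descendants (j : ℕ) (z : Fin d → ℤ) : Set (BoxIndex d) :=
  {b | j ≤ b.1 ∧ parent^[b.1 - j] b.2 = z}

lemma pairwise_disjoint_descendants (j : ℕ) :
    Pairwise (Function.onFun Disjoint (descendants (d := d) j)) := by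
  intro z z' hzz
  rw [Function.onFun, Set.disjoint_left]
  rintro b ⟨-, h⟩ ⟨-, h'⟩
  exact hzz (h.symm.trans h')

lemma coarsenCoins_descendants_subset (j : ℕ) (z : Fin d → ℤ) :
    coarsenCoins (descendants (j + 1)) z ⊆ descendants j z := by
  refine Set.iUnion₂_subset ?_
  rintro w rfl b ⟨h, rfl⟩
  refine ⟨by omega, ?_⟩
  rw [show b.1 - j = (b.1 - (j + 1)) + 1 by omega, Function.iterate_succ_apply']

lemma siteAdapted_openAt (j : ℕ) : SiteAdapted (descendants (d := d) j) (openAt j) :=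
  fun _ => measurableSet_coin ⟨le_rfl, by simp⟩

/-- The edges of scale `j` which are good if one looks `n` scales ahead. -/
def goodEdgesUpTo : ℕ → ℕ → Config d → Set ((Fin d → ℤ) × Fin d)
  | 0, _, _ => Set.univ
  | n + 1, j, ω => coarsen (openAt (j + 1) ω) (goodEdgesUpTo n (j + 1) ω)

/-- The good edges of scale `j`. -/
def goodEdges (j : ℕ) (ω : Config d) : Set ((Fin d → ℤ) × Fin d) := ⋂ n, goodEdgesUpTo n j ω

lemma antitone_goodEdgesUpTo (j : ℕ) (ω : Config d) : Antitone fun n => goodEdgesUpTo n j ω := by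
  refine antitone_nat_of_succ_le fun n => ?_
  induction n generalizing j with
  | zero => exact Set.subset_univ _
  | succ n ih => exact coarsen_mono _ (ih (j + 1))

/-- Thanks to this consistency one configuration can be refined through all scales; it rests on
compactness of coarsening. -/
lemma goodEdges_subset_coarsen (j : ℕ) (ω : Config d) :
    goodEdges j ω ⊆ coarsen (openAt (j + 1) ω) (goodEdges (j + 1) ω) := by
  refine Set.Subset.trans ?_ (iInter_coarsen_subset _ (antitone_goodEdgesUpTo (j + 1) ω))
  exact Set.subset_iInter fun n => Set.iInter_subset (fun n => goodEdgesUpTo n j ω) (n + 1)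

lemma edgeAdapted_goodEdgesUpTo (n j : ℕ) :
    EdgeAdapted (descendants (d := d) j) (goodEdgesUpTo n j) := by
  induction n generalizing j with
  | zero =>
    intro z i
    simp only [goodEdgesUpTo, Set.mem_univ, Set.ofPred_true]
    exact @MeasurableSet.univ _ (coinsOn _)
  | succ n ih =>
    exact (EdgeAdapted.coarsen (siteAdapted_openAt (j + 1)) (ih (j + 1))).mono
      (coarsenCoins_descendants_subset j)

lemma edgeAdapted_goodEdges (j : ℕ) : EdgeAdapted (descendants (d := d) j) (goodEdges j) :=
  EdgeAdapted.iInter fun n => edgeAdapted_goodEdgesUpTo n j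

/-- The open sites of height `k`: at height `0` the boxes of scale `0` whose coin shows "keep", at
positive height all sites. -/
def blockOpen : ℕ → Config d → Set (Fin d → ℤ)
  | 0, ω => openAt 0 ω
  | _ + 1, _ => Set.univ

/-- The good edges between the blocks of side length `2 ^ k`. -/
def blockEdges : ℕ → Config d → Set ((Fin d → ℤ) × Fin d)
  | 0, ω => goodEdges 0 ω
  | k + 1, ω => coarsen (blockOpen k ω) (blockEdges k ω)

/-- The coins attached to a block of side length `2 ^ k`. -/
def blockCoins : ℕ → (Fin d → ℤ) → Set (BoxIndex d)
  | 0 => descendants 0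
  | k + 1 => coarsenCoins (blockCoins k)

lemma pairwise_disjoint_blockCoins (k : ℕ) :
    Pairwise (Function.onFun Disjoint (blockCoins (d := d) k)) := by
  induction k with
  | zero => exact pairwise_disjoint_descendants 0
  | succ k ih => exact pairwise_disjoint_coarsenCoins ih

lemma edgeAdapted_blockEdges (k : ℕ) : EdgeAdapted (blockCoins (d := d) k) (blockEdges k) := by
  induction k with
  | zero => exact edgeAdapted_goodEdges 0
  | succ k ih =>
    refine EdgeAdapted.coarsen ?_ ih
    cases k with
    | zero => exact siteAdapted_openAt 0
    | succ k =>
      intro z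
      simp only [blockOpen, Set.mem_univ, Set.ofPred_true]
      exact @MeasurableSet.univ _ (coinsOn _)

lemma manyPaths_univ (hd : 10 ≤ d) (z : Fin d → ℤ) (i : Fin d) : ManyPaths Set.univ z i := by
  classical
  intro S hS
  have key : ∀ S' : Finset (Fin d), S'.card ≤ 9 → ∃ k, k ∉ S' := by
    intro S' hS'
    by_contra h
    push Not at h
    have h1 := Finset.card_le_card (fun k _ => h k : Finset.univ ⊆ S')
    rw [Finset.card_univ, Fintype.card_fin] at h1
    omega
  refine ⟨(key S (by omega)).imp fun k hk => ⟨hk, trivial⟩,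
    (key S (by omega)).imp fun k hk => ⟨hk, trivial⟩, fun a b => ?_⟩
  obtain ⟨k, hk⟩ := key (S ∪ {i, a, b}) (by
    have h2 := Finset.card_union_le S {i, a, b}
    have h3 : ({i, a, b} : Finset (Fin d)).card ≤ 3 := Finset.card_le_three
    omega)
  simp only [Finset.mem_union, Finset.mem_insert, Finset.mem_singleton, not_or] at hk
  exact ⟨k, hk, fun _ _ => trivial⟩

/-- The bound 2η reproduces itself: by `hp` the quadratic term of the recursion is at most η. -/
lemma measureReal_notMem_goodEdgesUpTo_le {p : I} (hd : 10 ≤ d)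
    (hp : 4 * ((6 * d ^ 3) ^ 2 * pathError d p) ≤ 1)
    (n j : ℕ) (z : Fin d → ℤ) (i : Fin d) :
    (law d p).real {ω | (z, i) ∉ goodEdgesUpTo n j ω} ≤ 2 * pathError d p := by
  have h0 := pathError_nonneg d p
  induction n generalizing j z i with
  | zero => simpa [goodEdgesUpTo] using h0
  | succ n ih =>
    refine (measureReal_notMem_coarsen_le p (pairwise_disjoint_descendants (j + 1))
      (edgeAdapted_goodEdgesUpTo n (j + 1)) z i
      (measureReal_not_manyPaths_le p (by omega) (j + 1) z i) (ih (j + 1))).trans ?_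
    nlinarith [mul_le_mul_of_nonneg_right hp h0]

lemma measureReal_notMem_goodEdges_le {p : I} (hd : 10 ≤ d)
    (hp : 4 * ((6 * d ^ 3) ^ 2 * pathError d p) ≤ 1)
    (j : ℕ) (z : Fin d → ℤ) (i : Fin d) :
    (law d p).real {ω | (z, i) ∉ goodEdges j ω} ≤ 2 * pathError d p := by
  have h1 : {ω : Config d | (z, i) ∉ goodEdges j ω} = ⋃ n, {ω | (z, i) ∉ goodEdgesUpTo n j ω} := by
    ext ω; simp [goodEdges]
  have h2 : Monotone fun n => {ω : Config d | (z, i) ∉ goodEdgesUpTo n j ω} :=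
    fun _ _ hmn _ hω h => hω (antitone_goodEdgesUpTo j _ hmn h)
  have h3 := tendsto_measure_iUnion_atTop (μ := law d p) h2
  have h4 := (ENNReal.tendsto_toReal (measure_ne_top _ _)).comp h3
  rw [h1]
  exact le_of_tendsto' h4 fun n => measureReal_notMem_goodEdgesUpTo_le hd hp n j z i

/-- Beyond the first step all sites are open and the additive error is zero, so the purely quadratic
recursion at least halves the bound. -/
lemma measureReal_notMem_blockEdges_le {p : I} (hd : 10 ≤ d)
    (hp : 4 * ((6 * d ^ 3) ^ 2 * pathError d p) ≤ 1)
    (k : ℕ) (z : Fin d → ℤ) (i : Fin d) :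
    (law d p).real {ω | (z, i) ∉ blockEdges (k + 1) ω} ≤ 2 * pathError d p * (1 / 2) ^ k := by
  have h0 := pathError_nonneg d p
  induction k generalizing z i with
  | zero =>
    refine (measureReal_notMem_coarsen_le p (pairwise_disjoint_descendants 0)
      (edgeAdapted_goodEdges 0) z i (measureReal_not_manyPaths_le p (by omega) 0 z i)
      (measureReal_notMem_goodEdges_le hd hp 0)).trans ?_
    nlinarith [mul_le_mul_of_nonneg_right hp h0]
  | succ k ih =>
    refine (measureReal_notMem_coarsen_le p (pairwise_disjoint_blockCoins (k + 1))
      (edgeAdapted_blockEdges (k + 1)) (o := blockOpen (k + 1)) (η := 0) z i ?_ ih).trans ?_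
    · simp [blockOpen, manyPaths_univ hd]
    · have h1 : (0 : ℝ) ≤ (1 / 2) ^ k := by positivity
      have h2 : ((1 : ℝ) / 2) ^ k ≤ 1 := pow_le_one₀ (by norm_num) (by norm_num)
      have h3 : pathError d p * (1 / 2) ^ k * (1 / 2) ^ k ≤ pathError d p * (1 / 2) ^ k :=
        mul_le_of_le_one_right (mul_nonneg h0 h1) h2
      have h4 := mul_le_mul_of_nonneg_right hp
        (mul_nonneg (mul_nonneg h0 h1) h1)
      rw [pow_succ (1 / 2 : ℝ) k]
      nlinarith

/-- With positive probability all blocks at the origin are connected to their neighbours. -/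
lemma measure_forall_mem_blockEdges_pos {p : I} (hd : 10 ≤ d)
    (hp : 4 * ((6 * d ^ 3) ^ 2 * pathError d p) ≤ 1)
    (hp' : 4 * (d * pathError d p) < 1) :
    0 < law d p {ω | ∀ k a, (0, a) ∈ blockEdges (k + 1) ω} := by
  have h0 := pathError_nonneg d p
  have hle : law d p {ω | ∀ k a, (0, a) ∈ blockEdges (k + 1) ω}ᶜ < 1 := by
    have hsub : {ω : Config d | ∀ k a, (0, a) ∈ blockEdges (k + 1) ω}ᶜ =
        ⋃ k, ⋃ a, {ω | (0, a) ∉ blockEdges (k + 1) ω} := by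
      ext ω; simp
    have hk : ∀ k : ℕ, law d p (⋃ a, {ω | (0, a) ∉ blockEdges (k + 1) ω}) ≤
        ENNReal.ofReal (d * (2 * pathError d p) * (1 / 2) ^ k) := by
      intro k
      rw [← ofReal_measureReal]
      refine ENNReal.ofReal_le_ofReal ((measureReal_iUnion_fintype_le _).trans ?_)
      refine (Finset.sum_le_sum fun a _ =>
        measureReal_notMem_blockEdges_le hd hp k 0 a).trans_eq ?_
      simp
      ring
    have hsum : HasSum (fun k : ℕ => d * (2 * pathError d p) * (1 / 2) ^ k)
        (d * (2 * pathError d p) * 2) := hasSum_geometric_two.mul_left _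
    rw [hsub]
    calc _ ≤ ∑' k, law d p (⋃ a, {ω | (0, a) ∉ blockEdges (k + 1) ω}) := measure_iUnion_le _
      _ ≤ ∑' k : ℕ, ENNReal.ofReal (d * (2 * pathError d p) * (1 / 2) ^ k) :=
        ENNReal.tsum_le_tsum hk
      _ = ENNReal.ofReal (d * (2 * pathError d p) * 2) := by
        rw [← ENNReal.ofReal_tsum_of_nonneg (fun k => by positivity) hsum.summable, hsum.tsum_eq]
      _ < 1 := by
        rw [ENNReal.ofReal_lt_one]
        linarith
  rw [pos_iff_ne_zero]
  intro hzero
  -- Subadditivity suffices here, with no need for measurability of the event.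
  have h1 := measure_union_le (μ := law d p) {ω | ∀ k a, (0, a) ∈ blockEdges (k + 1) ω}
    {ω | ∀ k a, (0, a) ∈ blockEdges (k + 1) ω}ᶜ
  rw [Set.union_compl_self, measure_univ, hzero, zero_add] at h1
  exact absurd hle (not_lt.2 h1)

end FractalPercolation

/-! ### Limits of refined polygonal paths -/

namespace FractalPercolation

open Relation

section PolygonalPaths

variable {X : Type*} [NormedAddCommGroup X] [NormedSpace ℝ X]

/-- The straight path from `x` to `y`. -/
noncomputable def segmentPath (x y : X) : Path x y where
  toFun t := AffineMap.lineMap x y (t : ℝ)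
  continuous_toFun := by fun_prop
  source' := by simp
  target' := by simp

lemma segmentPath_mem {s : Set X} (hs : Convex ℝ s) {x y : X} (hx : x ∈ s) (hy : y ∈ s) (t : I) :
    segmentPath x y t ∈ s :=
  hs.lineMap_mem hx hy t.2

/-- Paths composed of finitely many segments between points related by `R`. -/
inductive IsPolygonal (A : Set X) (R : X → X → Prop) : ∀ x y : X, Path x y → Prop
  | refl (x : X) : x ∈ A → IsPolygonal A R x x (Path.refl x)
  | segment (x y : X) : R x y → IsPolygonal A R x y (segmentPath x y)
  | trans (x y z : X) (γ : Path x y) (γ' : Path y z) :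
      IsPolygonal A R x y γ → IsPolygonal A R y z γ' → IsPolygonal A R x z (γ.trans γ')

lemma IsPolygonal.exists_near {A : Set X} {R : X → X → Prop} {C : ℝ} (hC : 0 ≤ C)
    (hR : ∀ x y, R x y → x ∈ A ∧ dist x y ≤ C) {x y : X} {γ : Path x y}
    (h : IsPolygonal A R x y γ) (t : I) : ∃ a ∈ A, dist (γ t) a ≤ C := by
  induction h generalizing t with
  | refl x hx => exact ⟨x, hx, by simpa using hC⟩
  | segment x y hxy =>
    refine ⟨x, (hR x y hxy).1, ?_⟩
    refine segmentPath_mem (convex_closedBall x C) (Metric.mem_closedBall_self hC) ?_ t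
    rw [Metric.mem_closedBall, dist_comm]
    exact (hR x y hxy).2
  | trans x y z γ γ' _ _ ih ih' =>
    rw [Path.trans_apply]
    split_ifs
    · exact ih _
    · exact ih' _

/-- Concatenation halves time at the same instant for the path and its refinement, so piecewise
bounds give a uniform bound. -/
lemma IsPolygonal.exists_refinement {A : Set X} {R S : X → X → Prop} {C : ℝ} (hC : 0 ≤ C)
    (hRS : ∀ x y, R x y → ∃ γ, IsPolygonal A S x y γ ∧ ∀ t, dist (segmentPath x y t) (γ t) ≤ C)
    {x y : X} {γ : Path x y} (h : IsPolygonal A R x y γ) :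
    ∃ γ' : Path x y, IsPolygonal A S x y γ' ∧ ∀ t, dist (γ t) (γ' t) ≤ C := by
  induction h with
  | refl x hx => exact ⟨_, .refl x hx, by simpa using hC⟩
  | segment x y hxy => exact hRS x y hxy
  | trans x y z γ γ' _ _ ih ih' =>
    obtain ⟨δ, hδ, hd⟩ := ih
    obtain ⟨δ', hδ', hd'⟩ := ih'
    refine ⟨δ.trans δ', .trans _ _ _ _ _ hδ hδ', fun t => ?_⟩
    rw [Path.trans_apply, Path.trans_apply]
    split_ifs
    · exact hd _
    · exact hd' _

lemma exists_isPolygonal_of_reflTransGen {A : Set X} {S : X → X → Prop} {C : ℝ} {p x y : X}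
    (hx : x ∈ A) (hpx : dist p x ≤ C)
    (h : ReflTransGen (fun u v => S u v ∧ dist p u ≤ C ∧ dist p v ≤ C) x y) :
    ∃ γ, IsPolygonal A S x y γ ∧ ∀ t, γ t ∈ Metric.closedBall p C := by
  induction h with
  | refl => exact ⟨_, .refl x hx, fun t => by simpa [dist_comm] using hpx⟩
  | @tail y z _ hyz ih =>
    obtain ⟨γ, hγ, hγp⟩ := ih
    refine ⟨γ.trans (segmentPath y z), .trans _ _ _ _ _ hγ (.segment _ _ hyz.1), fun t => ?_⟩
    rw [Path.trans_apply]
    split_ifs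
    · exact hγp _
    · refine segmentPath_mem (convex_closedBall p C) ?_ ?_ _ <;>
        rw [Metric.mem_closedBall, dist_comm]
      · exact hyz.2.1
      · exact hyz.2.2

/-- If points related at scale `j` are connected by chains of points related at scale `j + 1`, and
the diameters of these chains are summable, then points related at scale `0` are joined by
a path. -/
theorem joinedIn_of_refinement [CompleteSpace X] {A : Set X} (hA : IsClosed A) {C : ℝ} (hC : 0 ≤ C)
    (R : ℕ → X → X → Prop) (hRA : ∀ j x y, R j x y → x ∈ A)
    (hRd : ∀ j x y, R j x y → dist x y ≤ C / 2 ^ j)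
    (hR : ∀ j x y, R j x y → ReflTransGen
      (fun u v => R (j + 1) u v ∧ dist x u ≤ C / 2 ^ j ∧ dist x v ≤ C / 2 ^ j) x y)
    {x y : X} (hxy : R 0 x y) : JoinedIn A x y := by
  have hCj : ∀ j : ℕ, 0 ≤ C / 2 ^ j := fun j => by positivity
  -- A segment and its replacement both stay within `C / 2 ^ n` of its start; their sum is written
  -- in the shape of the geometric Cauchy criterion.
  have step : ∀ (n : ℕ) (γ : Path x y), IsPolygonal A (R n) x y γ → ∃ γ' : Path x y,
      IsPolygonal A (R (n + 1)) x y γ' ∧ ∀ t, dist (γ t) (γ' t) ≤ 4 * C / 2 / 2 ^ n := by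
    intro n γ hγ
    refine hγ.exists_refinement (by have := hCj n; positivity) fun u v huv => ?_
    obtain ⟨δ, hδ, hδu⟩ := exists_isPolygonal_of_reflTransGen (hRA n u v huv)
      (by simpa using hCj n) (hR n u v huv)
    refine ⟨δ, hδ, fun t => ?_⟩
    have h1 : segmentPath u v t ∈ Metric.closedBall u (C / 2 ^ n) := by
      refine segmentPath_mem (convex_closedBall u _) (Metric.mem_closedBall_self (hCj n)) ?_ t
      rw [Metric.mem_closedBall, dist_comm]
      exact hRd n u v huv
    have h2 := dist_triangle_right (segmentPath u v t) (δ t) u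
    have h3 := hδu t
    rw [Metric.mem_closedBall] at h1 h3
    calc _ ≤ C / 2 ^ n + C / 2 ^ n := h2.trans (add_le_add h1 h3)
      _ = 4 * C / 2 / 2 ^ n := by ring
  have : Nonempty (Path x y) := ⟨segmentPath x y⟩
  choose! F hF hFd using step
  let Γ : ℕ → Path x y := fun n => Nat.rec (segmentPath x y) F n
  have hΓ : ∀ n, IsPolygonal A (R n) x y (Γ n) := by
    intro n
    induction n with
    | zero => exact .segment x y hxy
    | succ n ih => exact hF n _ ih
  have hdist : ∀ n, dist ((Γ n).toContinuousMap) ((Γ (n + 1)).toContinuousMap) ≤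
      4 * C / 2 / 2 ^ n := fun n =>
    (ContinuousMap.dist_le (by positivity)).2 fun t => hFd n _ (hΓ n) t
  obtain ⟨f, hf⟩ := cauchySeq_tendsto_of_complete (cauchySeq_of_le_geometric_two hdist)
  have hft : ∀ t, Tendsto (fun n => Γ n t) atTop (𝓝 (f t)) := fun t =>
    ((continuous_eval_const t : Continuous fun g : C(I, X) => g t).tendsto f).comp hf
  refine ⟨⟨f, ?_, ?_⟩, fun t => ?_⟩
  · exact tendsto_nhds_unique (hft 0) (by simp)
  · exact tendsto_nhds_unique (hft 1) (by simp)
  -- The polygons may leave `A`, but each of their points is close to a vertex in `A`, so the limit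
  -- lies in the closed set `A`.
  · choose a ha had using fun n => (hΓ n).exists_near (hCj n)
      (fun u v huv => ⟨hRA n u v huv, hRd n u v huv⟩) t
    refine hA.mem_of_tendsto (f := a) (b := atTop) ?_ (Eventually.of_forall ha)
    have h0 : Tendsto (fun n : ℕ => C / 2 ^ n) atTop (𝓝 0) := by
      have := (tendsto_pow_atTop_nhds_zero_of_lt_one (r := (1 / 2 : ℝ)) (by norm_num)
        (by norm_num)).const_mul C
      simpa [div_eq_mul_inv] using this
    have h1 : Tendsto (fun n => dist (Γ n t) (a n)) atTop (𝓝 0) :=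
      squeeze_zero (fun _ => dist_nonneg) had h0
    exact (tendsto_iff_of_dist h1).1 (hft t)

end PolygonalPaths

/-- Infinitely many consecutive paths which leave every bounded set form an unbounded path. -/
lemma containsUnboundedPath_of_joinedIn {d : ℕ} {A : Set (EuclideanSpace ℝ (Fin d))}
    (x : ℕ → EuclideanSpace ℝ (Fin d)) (hx : ∀ n, JoinedIn A (x n) (x (n + 1)))
    (hx' : Tendsto (fun n => ‖x n‖) atTop atTop) : ContainsUnboundedPath A := by
  let P : ∀ n, Path (x n) (x (n + 1)) := fun n => (hx n).somePath
  let γ : ℝ → EuclideanSpace ℝ (Fin d) := fun t => (P ⌊t⌋₊).extend (t - ⌊t⌋₊)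
  have hγ : ∀ (n : ℕ) (t : ℝ), t ∈ Set.Icc (n : ℝ) (n + 1) → γ t = (P n).extend (t - n) := by
    intro n t ht
    rcases ht.2.lt_or_eq with h | rfl
    · have : ⌊t⌋₊ = n := (Nat.floor_eq_iff (n.cast_nonneg.trans ht.1)).2 ⟨ht.1, h⟩
      change (P ⌊t⌋₊).extend (t - ⌊t⌋₊) = _
      rw [this]
    -- At the right end the floor already selects the next path, which starts where this one ends.
    · have : ⌊(n : ℝ) + 1⌋₊ = n + 1 := by exact_mod_cast Nat.floor_natCast (R := ℝ) (n + 1)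
      change (P ⌊(n : ℝ) + 1⌋₊).extend ((n : ℝ) + 1 - ⌊(n : ℝ) + 1⌋₊) = _
      rw [this]
      simp
  have hcov : Set.Ici (0 : ℝ) ⊆ ⋃ n : ℕ, Set.Icc (n : ℝ) (n + 1) := fun t ht =>
    Set.mem_iUnion.2 ⟨⌊t⌋₊, Nat.floor_le ht, (Nat.lt_floor_add_one t).le⟩
  refine ⟨γ, ?_, ?_, ?_⟩
  · refine ContinuousOn.mono ?_ hcov
    refine LocallyFinite.continuousOn_iUnion ?_ (fun _ => isClosed_Icc) fun n => ?_
    · intro t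
      refine ⟨Set.Iio (t + 1), Iio_mem_nhds (by linarith), ?_⟩
      refine (Set.finite_Iic ⌈t + 1⌉₊).subset ?_
      rintro n ⟨s, hs, hs'⟩
      have h1 : (n : ℝ) ≤ t + 1 := hs.1.trans (le_of_lt hs')
      exact_mod_cast h1.trans (Nat.le_ceil _)
    · refine ContinuousOn.congr (f := fun t => (P n).extend (t - n)) ?_ fun t ht => hγ n t ht
      exact ((P n).continuous_extend.comp (by fun_prop)).continuousOn
  · rintro _ ⟨t, ht, rfl⟩
    have h1 : t - ⌊t⌋₊ ∈ Set.Icc (0 : ℝ) 1 :=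
      ⟨sub_nonneg.2 (Nat.floor_le ht), by have := Nat.lt_floor_add_one t; linarith⟩
    change (P ⌊t⌋₊).extend (t - ⌊t⌋₊) ∈ A
    rw [Path.extend_apply _ h1]
    exact (hx _).somePath_mem _
  · intro hb
    obtain ⟨M, hM⟩ := hb.exists_norm_le
    obtain ⟨n, hn⟩ := (hx'.eventually_gt_atTop M).exists
    have h1 : γ n = x n := by
      rw [hγ n n ⟨le_rfl, by linarith⟩]
      simp
    have := hM (γ n) ⟨n, Set.mem_Ici.2 n.cast_nonneg, rfl⟩
    rw [h1] at this
    linarith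

/-! ### Dyadic boxes, hub points and paths in the retained set -/

variable {d : ℕ}

lemma closedBox_parent {j : ℕ} {w : Fin d → ℤ} {x : EuclideanSpace ℝ (Fin d)}
    (hx : x ∈ closedBox (j + 1) w) : x ∈ closedBox j (parent w) := by
  intro c
  obtain ⟨h1, h2⟩ := hx c
  have h3 : ((2 * (parent w c) : ℤ) : ℝ) ≤ w c := by
    exact_mod_cast (by simp only [parent]; omega : 2 * (parent w c) ≤ w c)
  have h4 : ((w c : ℤ) : ℝ) ≤ (2 * (parent w c) + 1 : ℤ) := by
    exact_mod_cast (by simp only [parent]; omega : w c ≤ 2 * (parent w c) + 1)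
  push_cast at h3 h4
  have hpos : (0 : ℝ) < 2 ^ j := by positivity
  rw [pow_succ] at h1 h2
  constructor
  · refine le_trans ?_ h1
    rw [div_le_div_iff₀ hpos (by positivity)]
    nlinarith
  · refine h2.trans ?_
    rw [div_le_div_iff₀ (by positivity) hpos]
    nlinarith

lemma isClosed_closedBox (j : ℕ) (z : Fin d → ℤ) : IsClosed (closedBox j z) := by
  have : closedBox j z = ⋂ c, {x : EuclideanSpace ℝ (Fin d) | (z c : ℝ) / 2 ^ j ≤ x c} ∩
      {x | x c ≤ ((z c : ℝ) + 1) / 2 ^ j} := by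
    ext x
    simp [closedBox]
  rw [this]
  refine isClosed_iInter fun c => ?_
  have hc : Continuous fun x : EuclideanSpace ℝ (Fin d) => x c := by fun_prop
  exact (isClosed_le continuous_const hc).inter (isClosed_le hc continuous_const)

lemma locallyFinite_closedBox (j : ℕ) : LocallyFinite (closedBox (d := d) j) := by
  intro x
  refine ⟨Metric.ball x 1, Metric.ball_mem_nhds x one_pos, ?_⟩
  refine (Set.finite_Icc (fun c => ⌊(x c - 1) * 2 ^ j⌋ - 1) (fun c => ⌈(x c + 1) * 2 ^ j⌉)).subset ?_
  rintro z ⟨y, hy, hyx⟩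
  have hpos : (0 : ℝ) < 2 ^ j := by positivity
  have hc : ∀ c, |y c - x c| < 1 := fun c =>
    (PiLp.norm_apply_le (y - x) c).trans_lt (by rwa [Metric.mem_ball, dist_eq_norm] at hyx)
  constructor
  · intro c
    obtain ⟨-, h2⟩ := hy c
    rw [le_div_iff₀ hpos] at h2
    have h3 : (x c - 1) * 2 ^ j ≤ y c * 2 ^ j := by
      have := (abs_lt.1 (hc c)).1
      gcongr
      linarith
    have h4 := Int.floor_le ((x c - 1) * 2 ^ j)
    have h5 : (⌊(x c - 1) * 2 ^ j⌋ : ℝ) ≤ (z c + 1 : ℤ) := by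
      push_cast
      linarith
    have h6 : ⌊(x c - 1) * 2 ^ j⌋ ≤ z c + 1 := by exact_mod_cast h5
    simp only
    omega
  · intro c
    obtain ⟨h1, -⟩ := hy c
    rw [div_le_iff₀ hpos] at h1
    have h3 : y c * 2 ^ j ≤ (x c + 1) * 2 ^ j := by
      have := (abs_lt.1 (hc c)).2
      gcongr
      linarith
    have h4 := Int.le_ceil ((x c + 1) * 2 ^ j)
    have h5 := h1.trans (h3.trans h4)
    exact Int.cast_le.1 h5

lemma isClosed_retainedSet (ω : Config d) : IsClosed (retainedSet ω) := by
  refine isClosed_iInter fun j => ?_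
  rw [Set.biUnion_eq_iUnion]
  exact ((locallyFinite_closedBox j).comp_injective Subtype.val_injective).isClosed_iUnion
    fun z => isClosed_closedBox j z.1

/-- Scales coarser than `j` come for free, since ancestors of retained boxes are retained. -/
lemma mem_retainedSet {ω : Config d} {x : EuclideanSpace ℝ (Fin d)} (j : ℕ)
    (h : ∀ n, ∃ z ∈ retainedBoxes ω (j + n), x ∈ closedBox (j + n) z) : x ∈ retainedSet ω := by
  have key : ∀ m J, (∃ z ∈ retainedBoxes ω (J + m), x ∈ closedBox (J + m) z) →
      ∃ z ∈ retainedBoxes ω J, x ∈ closedBox J z := by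
    intro m
    induction m with
    | zero => exact fun J h => h
    | succ m ih =>
      rintro J ⟨z, hz, hx⟩
      exact ih J ⟨parent z, hz.1, closedBox_parent hx⟩
  refine Set.mem_iInter.2 fun J => ?_
  obtain ⟨z, hz, hx⟩ := key j J (by rw [add_comm]; exact h J)
  exact Set.mem_iUnion₂.2 ⟨z, hz, hx⟩

/-- The points determined by infinite nested sequences of hubs. -/
lemma exists_hubPoint (hub : ℕ → (Fin d → ℤ) → (Fin d → ℤ)) (hhub : ∀ j z, parent (hub j z) = z) :
    ∃ h : ℕ → (Fin d → ℤ) → EuclideanSpace ℝ (Fin d), (∀ j z, h j z ∈ closedBox j z) ∧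
      ∀ j z, h (j + 1) (hub j z) = h j z := by
  let it : ℕ → ℕ → (Fin d → ℤ) → (Fin d → ℤ) := fun j n z => Nat.rec z (fun n w => hub (j + n) w) n
  have it_succ : ∀ j n z, it j (n + 1) z = hub (j + n) (it j n z) := fun _ _ _ => rfl
  have it_shift : ∀ j n z, it (j + 1) n (hub j z) = it j (n + 1) z := by
    intro j n z
    induction n with
    | zero => rfl
    | succ n ih => rw [it_succ, ih, it_succ j (n + 1), add_right_comm, add_assoc]
  let a : ℕ → (Fin d → ℤ) → Fin d → ℕ → ℝ := fun j z c n => (Int.cast (it j n z c) : ℝ) / 2 ^ (j + n)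
  have hbd : ∀ j z c, (hub j z c = 2 * z c ∨ hub j z c = 2 * z c + 1) := by
    intro j z c
    have := congrFun (hhub j z) c
    simp only [parent] at this
    omega
  have amono : ∀ j z c, Monotone (a j z c) := by
    intro j z c
    refine monotone_nat_of_le_succ fun n => ?_
    simp only [a, it_succ]
    rw [← add_assoc, pow_succ, div_le_div_iff₀ (by positivity) (by positivity)]
    have h1 : (2 : ℝ) * (Int.cast (it j n z c) : ℝ) ≤ hub (j + n) (it j n z) c := by
      rcases hbd (j + n) (it j n z) c with h | h <;> rw [h] <;> push_cast <;> linarith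
    nlinarith [show (0 : ℝ) < 2 ^ (j + n) by positivity]
  have abdd : ∀ j z c n, a j z c n ≤ ((z c : ℝ) + 1) / 2 ^ j := by
    intro j z c n
    have key : ((Int.cast (it j n z c) : ℝ) + 1) / 2 ^ (j + n) ≤ ((z c : ℝ) + 1) / 2 ^ j := by
      induction n with
      | zero => exact le_rfl
      | succ n ih =>
        refine le_trans ?_ ih
        rw [it_succ, ← add_assoc, pow_succ, div_le_div_iff₀ (by positivity) (by positivity)]
        have h1 : (hub (j + n) (it j n z) c : ℝ) ≤ 2 * (Int.cast (it j n z c) : ℝ) + 1 := by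
          rcases hbd (j + n) (it j n z) c with h | h <;> rw [h] <;> push_cast <;> linarith
        nlinarith [show (0 : ℝ) < 2 ^ (j + n) by positivity]
    refine le_trans ?_ key
    simp only [a]
    gcongr
    linarith
  have hba : ∀ j z c, BddAbove (Set.range (a j z c)) := fun j z c =>
    ⟨_, Set.forall_mem_range.2 (abdd j z c)⟩
  refine ⟨fun j z => WithLp.toLp 2 fun c => ⨆ n, a j z c n, fun j z c => ⟨?_, ?_⟩, fun j z => ?_⟩
  · exact le_ciSup (hba j z c) 0
  · exact ciSup_le (abdd j z c)
  · refine congrArg (WithLp.toLp 2) (funext fun c => ?_)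
    -- The lower corners for `hub j z` are the tail of those for `z`, so both have the same limit.
    have h1 := tendsto_atTop_ciSup (amono j z c) (hba j z c)
    have h2 := tendsto_atTop_ciSup (amono (j + 1) (hub j z) c) (hba _ _ _)
    refine tendsto_nhds_unique h2 (((tendsto_add_atTop_iff_nat 1).2 h1).congr fun n => ?_)
    simp only [a, it_shift]
    rw [add_right_comm, add_assoc]

lemma dist_le_of_closedBox {j : ℕ} {z y : Fin d → ℤ} {u v : EuclideanSpace ℝ (Fin d)}
    (hu : u ∈ closedBox j z) (hv : v ∈ closedBox j y) (h : ∀ c, |y c - z c| ≤ 2) :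
    dist u v ≤ 3 * √d / 2 ^ j := by
  have hc : ∀ c, dist (u c) (v c) ≤ 3 / 2 ^ j := by
    intro c
    have h1 := hu c
    have h2 := hv c
    have h3 : |(y c : ℝ) - z c| ≤ 2 := by exact_mod_cast h c
    rw [abs_le] at h3
    have hpos : (0 : ℝ) < 2 ^ j := by positivity
    rw [div_le_iff₀ hpos, le_div_iff₀ hpos] at h1 h2
    rw [Real.dist_eq, abs_le, ← neg_div, div_le_iff₀ hpos, le_div_iff₀ hpos]
    constructor <;> linarith
  rw [EuclideanSpace.dist_eq]
  refine (Real.sqrt_le_sqrt (Finset.sum_le_sum fun c _ =>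
    pow_le_pow_left₀ dist_nonneg (hc c) 2)).trans_eq ?_
  rw [Finset.sum_const, Finset.card_univ, Fintype.card_fin, nsmul_eq_mul,
    Real.sqrt_mul (Nat.cast_nonneg d), Real.sqrt_sq (by positivity)]
  ring

/-- Linked unit boxes contain points which are joined by a path in the retained set. -/
theorem exists_joinedIn_retainedSet (ω : Config d) :
    ∃ h : (Fin d → ℤ) → EuclideanSpace ℝ (Fin d), (∀ z, h z ∈ closedBox 0 z) ∧
      ∀ z z', Link (openAt 0 ω) (goodEdges 0 ω) z z' →
        JoinedIn (retainedSet ω) (h z) (h z') := by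
  -- Goodness refers to single coins, which preserves independence. Below retained boxes a child is
  -- retained exactly when its coin shows "keep", so the two notions agree where needed.
  have hex : ∀ j, ∀ z i, z ∈ retainedBoxes ω j → z + basisVec i ∈ retainedBoxes ω j →
      (z, i) ∈ goodEdges j ω →
      (z, i) ∈ coarsen (retainedBoxes ω (j + 1)) (goodEdges (j + 1) ω) := by
    intro j z i hz hz' hg
    refine HubsLinked.mono ?_ (fun _ _ _ _ h => h) (goodEdges_subset_coarsen j ω hg)
    intro w hw
    have hp : parent w ∈ retainedBoxes ω j := by
      rcases hw with hw | hw <;> rw [hw] <;> assumption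
    exact ⟨fun h => ⟨hp, h⟩, fun h => h.2⟩
  choose hub hhub hlink using fun j => exists_hub (hex j)
  obtain ⟨h, hbox, hh⟩ := exists_hubPoint hub hhub
  refine ⟨h 0, hbox 0, fun z z' hzz => ?_⟩
  -- The hub of a linked box is linked one scale finer, hence retained, and the induction continues.
  have hmem : ∀ n j z, (∃ z', Link (retainedBoxes ω j) (goodEdges j ω) z z') →
      ∃ w ∈ retainedBoxes ω (j + n), h j z ∈ closedBox (j + n) w := by
    intro n
    induction n with
    | zero => exact fun j z ⟨z', hl⟩ => ⟨z, hl.1, hbox j z⟩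
    | succ n ih =>
      rintro j z ⟨z', hl⟩
      have := ih (j + 1) (hub j z) (hlink j z z' hl).2.1
      rw [hh] at this
      rwa [add_right_comm, add_assoc] at this
  refine joinedIn_of_refinement (isClosed_retainedSet ω) (C := 3 * √d) (by positivity)
    (fun j x y => ∃ z z', Link (retainedBoxes ω j) (goodEdges j ω) z z' ∧ h j z = x ∧ h j z' = y)
    ?_ ?_ ?_ ⟨z, z', hzz, rfl, rfl⟩
  · rintro j _ _ ⟨z, z', hl, rfl, rfl⟩
    exact mem_retainedSet j fun n => hmem n j z ⟨z', hl⟩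
  · rintro j _ _ ⟨z, z', ⟨-, -, k, hk⟩, rfl, rfl⟩
    refine dist_le_of_closedBox (hbox j z) (hbox j z') fun c => ?_
    rcases hk with ⟨rfl, -⟩ | ⟨rfl, -⟩ <;>
    · simp only [Pi.add_apply, Pi.single_apply]
      split_ifs <;> simp
  · rintro j _ _ ⟨z, z', hl, rfl, rfl⟩
    have := (hlink j z z' hl).2.2
    rw [← hh j z, ← hh j z']
    refine ReflTransGen.lift (h (j + 1)) ?_ _ _ this
    rintro w w' ⟨hw, hn, hn'⟩
    refine ⟨⟨w, w', hw, rfl, rfl⟩, ?_, ?_⟩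
    · rw [hh]
      exact dist_le_of_closedBox (hbox j z) (closedBox_parent (hbox _ _)) hn
    · rw [hh]
      exact dist_le_of_closedBox (hbox j z) (closedBox_parent (hbox _ _)) hn'

lemma two_pow_le_of_iterate_parent {n : ℕ} {w : Fin d → ℤ} {a : Fin d}
    (h : 1 ≤ parent^[n] w a) : 2 ^ n ≤ w a := by
  induction n generalizing w with
  | zero => simpa using h
  | succ n ih =>
    rw [Function.iterate_succ_apply] at h
    have := ih h
    simp only [parent] at this
    rw [pow_succ]
    omega

/-- If all blocks at the origin are connected to their neighbours, then there is an unbounded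
path. -/
theorem containsUnboundedPath_of_blockEdges (hd : 0 < d) (ω : Config d)
    (hω : ∀ k a, (0, a) ∈ blockEdges (k + 1) ω) : ContainsUnboundedPath (retainedSet ω) := by
  obtain ⟨h, hbox, hjoin⟩ := exists_joinedIn_retainedSet ω
  have hex : ∀ k, ∀ z i, z ∈ blockOpen (k + 1) ω → z + basisVec i ∈ blockOpen (k + 1) ω →
      (z, i) ∈ blockEdges (k + 1) ω → (z, i) ∈ coarsen (blockOpen k ω) (blockEdges k ω) :=
    fun _ _ _ _ _ hg => hg
  choose hub hhub hlink using fun k => exists_hub (hex k)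
  -- `φ k` descends through hubs from a block of height `k` to a unit box inside it.
  let φ : ℕ → (Fin d → ℤ) → (Fin d → ℤ) := fun k => Nat.rec id (fun k f z => f (hub k z)) k
  have φ_succ : ∀ k z, φ (k + 1) z = φ k (hub k z) := fun _ _ => rfl
  have hφp : ∀ k z, parent^[k] (φ k z) = z := by
    intro k
    induction k with
    | zero => exact fun z => rfl
    | succ k ih =>
      intro z
      rw [Function.iterate_succ_apply', φ_succ, ih, hhub]
  have hφ : ∀ k z z', ReflTransGen (Link (blockOpen k ω) (blockEdges k ω)) z z' →
      ReflTransGen (Link (openAt 0 ω) (goodEdges 0 ω)) (φ k z) (φ k z') := by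
    intro k
    induction k with
    | zero => exact fun z z' h => h
    | succ k ih =>
      intro z z' hzz
      induction hzz with
      | refl => exact .refl
      | tail _ hl hi =>
        refine hi.trans (ih _ _ ?_)
        exact ReflTransGen.mono (fun _ _ h => h.1) _ _ (hlink k _ _ hl).2.2
  have hchain : ∀ k, ∃ a, φ (k + 2) 0 = φ (k + 1) (basisVec a) ∧
      ReflTransGen (Link (openAt 0 ω) (goodEdges 0 ω)) (φ (k + 1) 0) (φ (k + 2) 0) := by
    intro k
    have hl : ∀ n a, Link (blockOpen (n + 1) ω) (blockEdges (n + 1) ω) 0 (basisVec a) :=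
      fun n a => ⟨trivial, trivial, a, Or.inl ⟨(zero_add _).symm, hω n a⟩⟩
    -- Any link at the origin forces its hub to be some `e_a`. The direction `a` is not under
    -- control, which is why all directions are required to be good.
    obtain ⟨a, ha⟩ := (hlink (k + 1) 0 _ (hl (k + 1) ⟨0, hd⟩)).1
    rw [zero_add, zero_add] at ha
    refine ⟨a, by rw [φ_succ, ha], ?_⟩
    rw [φ_succ (k + 1), ha]
    exact hφ (k + 1) _ _ (.single (hl k a))
  have hjoin' : ∀ z z', ReflTransGen (Link (openAt 0 ω) (goodEdges 0 ω)) z z' →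
      h z ∈ retainedSet ω → JoinedIn (retainedSet ω) (h z) (h z') := by
    intro z z' hzz hz
    induction hzz with
    | refl => exact JoinedIn.refl hz
    | tail _ hl ih => exact ih.trans (hjoin _ _ hl)
  refine containsUnboundedPath_of_joinedIn (fun k => h (φ (k + 1) 0)) (fun k => ?_) ?_
  · obtain ⟨a, ha, hp⟩ := hchain k
    refine hjoin' _ _ hp ?_
    rcases ReflTransGen.cases_head hp with heq | ⟨w, hw, -⟩
    · exfalso
      have h1 := congrArg (parent^[k + 1]) heq
      rw [ha, hφp, hφp] at h1
      have := congrFun h1 a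
      simp at this
    · exact (hjoin _ _ hw).source_mem
  · refine (tendsto_add_atTop_iff_nat 1).1 ?_
    refine tendsto_atTop_mono (f := fun n : ℕ => (2 : ℝ) ^ n) (fun k => ?_)
      (tendsto_pow_atTop_atTop_of_one_lt one_lt_two)
    obtain ⟨a, ha, -⟩ := hchain k
    have h1 : 2 ^ (k + 1) ≤ φ (k + 2) 0 a := by
      apply two_pow_le_of_iterate_parent
      rw [ha, hφp]
      simp
    have h2 := (hbox (φ (k + 2) 0) a).1
    have h3 : ((2 : ℝ) ^ (k + 1)) ≤ (Int.cast (φ (k + 2) 0 a) : ℝ) := by exact_mod_cast h1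
    have h4 := (le_abs_self _).trans (PiLp.norm_apply_le (h (φ (k + 2) 0)) a)
    have h5 : (2 : ℝ) ^ k ≤ 2 ^ (k + 1) := pow_le_pow_right₀ one_le_two (by omega)
    simp only [pow_zero, div_one] at h2
    exact h5.trans (h3.trans (h2.trans h4))

end FractalPercolation

/-! ### Asymptotics in the dimension and conclusion -/

namespace FractalPercolation

lemma eventually_pathError_small {p : I} (hp0 : (0 : ℝ) < p) (hp1 : (p : ℝ) < 1) :
    ∀ᶠ d : ℕ in atTop, 4 * ((6 * (d : ℝ) ^ 3) ^ 2 * pathError d p) < 1 := by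
  set r : ℝ := 1 - (p : ℝ) ^ 5 with hr
  have hr0 : 0 < r := by
    have := pow_lt_one₀ hp0.le hp1 (n := 5) (by norm_num)
    linarith
  have hr1 : r < 1 := by
    have := pow_pos hp0 5
    linarith
  have h := tendsto_pow_const_mul_const_pow_of_abs_lt_one 14 (by rwa [abs_of_pos hr0] : |r| < 1)
  -- The power 14 is 6 + 6 + 2, the constant 432 is 4 · 36 · 3 with `d ^ 2 + 2 ≤ 3 d ^ 2`, and `r ^
  -- 9` offsets the exponent `d - 9`.
  filter_upwards [h.eventually_lt_const (show (0 : ℝ) < r ^ 9 / 432 by positivity),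
    eventually_ge_atTop 10] with d hd hd10
  have h1 : r ^ d = r ^ (d - 9) * r ^ 9 := by rw [← pow_add]; congr 1; omega
  have h2 : (1 : ℝ) ≤ (d : ℝ) ^ 2 := one_le_pow₀ (by exact_mod_cast (by omega : 1 ≤ d))
  rw [h1, lt_div_iff₀ (by norm_num), ← mul_assoc] at hd
  have h3 : (d : ℝ) ^ 14 * r ^ (d - 9) * 432 < 1 := by
    by_contra hcon
    have := mul_le_mul_of_nonneg_right (not_lt.1 hcon) (pow_pos hr0 9).le
    linarith
  refine lt_of_le_of_lt ?_ h3
  calc 4 * ((6 * (d : ℝ) ^ 3) ^ 2 * pathError d p)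
      = 144 * ((d : ℝ) ^ 12 * r ^ (d - 9)) * (d ^ 2 + 2) := by
        rw [pathError, ← hr]
        ring
    _ ≤ 144 * ((d : ℝ) ^ 12 * r ^ (d - 9)) * (3 * d ^ 2) := by
        gcongr
        linarith
    _ = (d : ℝ) ^ 14 * r ^ (d - 9) * 432 := by ring

lemma eventually_criticalProbability_le {p : I} (hp0 : (0 : ℝ) < p) (hp1 : (p : ℝ) < 1) :
    ∀ᶠ d : ℕ in atTop, criticalProbability d ≤ p := by
  filter_upwards [eventually_pathError_small hp0 hp1, eventually_ge_atTop 10] with d hd hd10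
  have h0 := pathError_nonneg d p
  have hle : (d : ℝ) ≤ (6 * (d : ℝ) ^ 3) ^ 2 := by
    have h1 : (1 : ℝ) ≤ d := by exact_mod_cast (by omega : 1 ≤ d)
    have h2 : (d : ℝ) ≤ (d : ℝ) ^ 6 := le_self_pow₀ h1 (by norm_num)
    nlinarith
  have hpos := measure_forall_mem_blockEdges_pos hd10 hd.le
    ((mul_le_mul_of_nonneg_left (mul_le_mul_of_nonneg_right hle h0) (by norm_num)).trans_lt hd)
  have hmem : p ∈ {p : I | 0 < law d p {ω | ContainsUnboundedPath (retainedSet ω)}} :=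
    hpos.trans_le (measure_mono fun ω hω => containsUnboundedPath_of_blockEdges (by omega) ω hω)
  exact_mod_cast sInf_le hmem

end FractalPercolation

theorem theorem1p4 :
    Tendsto (fun d : ℕ => FractalPercolation.criticalProbability d) atTop (𝓝 (0 : ℝ)) := by
  refine tendsto_order.2 ⟨fun a ha => ?_, fun a ha => ?_⟩
  · exact Eventually.of_forall fun d => ha.trans_le (Subtype.prop (p := (· ∈ Set.Icc (0 : ℝ) 1)) _).1
  -- The value `a / 2` gives a strict inequality, and the cap `1 / 2` keeps the parameter below 1.
  · have hp0 : 0 < min (a / 2) (1 / 2) := by positivity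
    have hp1 : min (a / 2) (1 / 2) ≤ 1 / 2 := min_le_right _ _
    have hpa : min (a / 2) (1 / 2) ≤ a / 2 := min_le_left _ _
    have hpI : min (a / 2) (1 / 2) ∈ I := ⟨hp0.le, by linarith⟩
    filter_upwards [FractalPercolation.eventually_criticalProbability_le (p := ⟨_, hpI⟩) hp0
      (by change min (a / 2) (1 / 2) < 1; linarith)] with d hd
    change _ ≤ min (a / 2) (1 / 2) at hd
    linarith
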